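/- Let $S$ be a scheme, let $T$ be a split torus of rank $t$ over $S$, with a fixed isomorphism of group schemes $T \cong \mathbb{G}_{m,S}^t$, and let $X$ be a quasi-compact scheme over $S$ with the trivial $T$-action. Let $\mathrm{sPerf}(X)$ be the dg category of bounded complexes of finite locally free $\mathcal{O}_X$-modules, and let $\mathcal{A} = \mathrm{sPerf}^T(X)$ be the dg category of bounded complexes of $T$-equivariant finite locally free $\mathcal{O}_X$-modules. (A $T$-equivariant $\mathcal{O}_X$-module is an $\mathcal{O}_X$-module $\mathcal{F}$ with an isomorphism $\theta^*\mathcal{F} \cong p_2^*\mathcal{F}$ on $T \times_S X$ satisfying the cocycle condition, where $\theta$ is the action and $p_2$ the projection; here $\theta = p_2$.) Write $[-,-]^T$ for the mapping complexes of $\mathcal{A}$. For $\lambda \in \mathbb{Z}^t$, a $T$-equivariant module is concentrated in multi-degree $\lambda$ if $T$ acts on it through the character $(z_1, \dots, z_t) \mapsto z_1^{\lambda_1} \cdots z_t^{\lambda_t}$, that is, if its structure isomorphism is multiplication by this character. Let $\mathcal{A}_\lambda \subset \mathcal{A}$ be the full dg subcategory of the complexes all of whose terms are concentrated in multi-degree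 $\lambda$. Then: 1. for each $\lambda \in \mathbb{Z}^t$, the dg functor $\mathcal{A}_\lambda \to \mathrm{sPerf}(X)$ that forgets the $T$-equivariant structure is an equivalence of dg categories (it is bijective on mapping complexes, and every object of $\mathrm{sPerf}(X)$ is isomorphic, by closed morphisms of degree $0$, to one in the image); 2. for $\mu \neq \lambda$ in $\mathbb{Z}^t$, $M \in \mathcal{A}_\mu$ and $L \in \mathcal{A}_\lambda$, the mapping complexes vanish: $[M,L]^T = 0$ and $[L,M]^T = 0$; 3. for every total order on $\mathbb{Z}^t$ there is a semi-orthogonal decomposition $\mathcal{A} = \langle \mathcal{A}_\lambda \mid \lambda \in \mathbb{Z}^t \rangle$. That is, in the triangulated category $H^0(\mathcal{A})$, the bounded homotopy category of $T$-equivariant finite locally free $\mathcal{O}_X$-modules, the $\mathcal{A}_\lambda$ are full triangulated subcategories (up to isomorphism), there are no nonzero morphisms from objects of $\mathcal{A}_\mu$ to objects of $\mathcal{A}_\lambda$ for $\lambda < \mu$, and the smallest strictly full triangulated subcategory containing all $\mathcal{A}_\lambda$ is $H^0(\mathcal{A})$. -/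

import Mathlib

open CategoryTheory Limits AlgebraicGeometry MonoidalCategory CartesianMonoidalCategory MonObj
open ZeroObject Pretriangulated

universe u v w v₁ v₂ w₁ w₂

noncomputable section

namespace TorusPerf

/-! ### Differential graded categories -/

/-- A dg category (over `ℤ`): mapping complexes `hom X Y` with differential `d` of degree one,
bilinear associative composition (written in diagrammatic order) satisfying the Leibniz rule
`d (g ∘ f) = dg ∘ f + (-1) ^ |g| • g ∘ df`, and identities. That the identities are closed
follows from the Leibniz rule. -/
class DGCategory (C : Type w) where
  /-- the degree `n` part of the mapping complex -/
  hom : C → C → ℤ → Type v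
  [addCommGroup (X Y : C) (n : ℤ) : AddCommGroup (hom X Y n)]
  /-- the differential -/
  d {X Y : C} (n m : ℤ) (h : n + 1 = m) : hom X Y n →+ hom X Y m
  d_d {X Y : C} (n m p : ℤ) (h : n + 1 = m) (h' : m + 1 = p) (f : hom X Y n) :
    d m p h' (d n m h f) = 0
  id (X : C) : hom X X 0
  comp {X Y Z : C} {n m p : ℤ} (h : n + m = p) : hom X Y n →+ hom Y Z m →+ hom X Z p
  id_comp {X Y : C} {n : ℤ} (f : hom X Y n) : comp (zero_add n) (id X) f = f
  comp_id {X Y : C} {n : ℤ} (f : hom X Y n) : comp (add_zero n) f (id Y) = f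
  assoc {X Y Z W : C} {n m p nm mp q : ℤ} (hnm : n + m = nm) (hmp : m + p = mp)
    (h : nm + p = q) (h' : n + mp = q) (f : hom X Y n) (g : hom Y Z m) (k : hom Z W p) :
    comp h (comp hnm f g) k = comp h' f (comp hmp g k)
  leibniz {X Y Z : C} {n m p n' m' p' : ℤ} (h : n + m = p) (hn : n + 1 = n') (hm : m + 1 = m')
    (hp : p + 1 = p') (f : hom X Y n) (g : hom Y Z m) :
    d p p' hp (comp h f g) =
      comp (by omega) f (d m m' hm g) + m.negOnePow • comp (by omega) (d n n' hn f) g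

attribute [reducible, instance] DGCategory.addCommGroup

/-- A dg functor. -/
structure DGFunctor (C : Type w₁) (D : Type w₂) [DGCategory.{v₁} C] [DGCategory.{v₂} D] where
  obj : C → D
  map {X Y : C} (n : ℤ) : DGCategory.hom X Y n →+ DGCategory.hom (obj X) (obj Y) n
  map_d {X Y : C} (n m : ℤ) (h : n + 1 = m) (f : DGCategory.hom X Y n) :
    map m (DGCategory.d n m h f) = DGCategory.d n m h (map n f)
  map_id (X : C) : map 0 (DGCategory.id X) = DGCategory.id (obj X)
  map_comp {X Y Z : C} {n m p : ℤ} (h : n + m = p) (f : DGCategory.hom X Y n)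
    (g : DGCategory.hom Y Z m) :
    map p (DGCategory.comp h f g) = DGCategory.comp h (map n f) (map m g)

/-- A dg functor is an equivalence of dg categories if it induces isomorphisms on mapping
complexes and every object of the target is isomorphic, through closed morphisms of degree `0`,
to an object in the image. -/
structure DGFunctor.IsEquivalence {C : Type w₁} {D : Type w₂} [DGCategory.{v₁} C]
    [DGCategory.{v₂} D] (F : DGFunctor C D) : Prop where
  bijective (X Y : C) (n : ℤ) : Function.Bijective (F.map (X := X) (Y := Y) n)
  essSurj (Z : D) : ∃ (X : C) (f : DGCategory.hom (F.obj X) Z 0)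
    (g : DGCategory.hom Z (F.obj X) 0),
    DGCategory.d 0 1 (zero_add 1) f = 0 ∧ DGCategory.d 0 1 (zero_add 1) g = 0 ∧
    DGCategory.comp (zero_add 0) f g = DGCategory.id (F.obj X) ∧
    DGCategory.comp (zero_add 0) g f = DGCategory.id Z

section Complexes

variable {C : Type*} [Category* C] [Preadditive C] {D : Type*} [Category* D] [Preadditive D]

open CochainComplex HomComplex

/-- The dg category of the cochain complexes that satisfy `P`: the mapping complexes are the
usual total Hom complexes. -/
instance complexDGCategory (P : ObjectProperty (CochainComplex C ℤ)) : DGCategory P.FullSubcategory where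
  hom K L n := Cochain K.obj L.obj n
  d n m _ := (δ_hom ℤ _ _ n m).toAddMonoidHom
  d_d n m p _ _ f := δ_δ n m p f
  id K := Cochain.ofHom (𝟙 K.obj)
  comp h := AddMonoidHom.mk' (fun f => AddMonoidHom.mk' (fun g => f.comp g h) (by simp)) (by
    intro a b; ext; simp)
  id_comp f := Cochain.id_comp f
  comp_id f := Cochain.comp_id f
  assoc hnm hmp h h' f g k := Cochain.comp_assoc f g k hnm hmp (by omega)
  leibniz h hn hm hp f g := δ_comp f g h _ _ _ hp hn hm

/-- The dg functor between dg categories of complexes induced by an additive functor. -/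
def mapComplexDG (Φ : C ⥤ D) [Φ.Additive] (P : ObjectProperty (CochainComplex C ℤ))
    (Q : ObjectProperty (CochainComplex D ℤ))
    (h : ∀ K, P K → Q ((Φ.mapHomologicalComplex _).obj K)) :
    DGFunctor P.FullSubcategory Q.FullSubcategory where
  obj K := ⟨(Φ.mapHomologicalComplex _).obj K.obj, h _ K.property⟩
  map n := AddMonoidHom.mk' (fun f => Cochain.map f Φ) (fun f g => Cochain.map_add f g Φ)
  map_d n m _ f := (δ_map n m f Φ).symm
  map_id K := by
    change Cochain.map (Cochain.ofHom (𝟙 K.obj)) Φ = Cochain.ofHom (𝟙 _)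
    rw [Cochain.map_ofHom, CategoryTheory.Functor.map_id]
  map_comp h f g := by
    apply Cochain.map_comp
    exact h

variable (C) in
/-- The bounded cochain complexes. -/
def boundedComplexes : ObjectProperty (CochainComplex C ℤ) := fun K =>
  ∃ a b : ℤ, K.IsStrictlyGE a ∧ K.IsStrictlyLE b

variable (C) in
/-- The bounded complexes, as objects of the homotopy category. -/
def hoBounded : ObjectProperty (HomotopyCategory C (.up ℤ)) := fun K => boundedComplexes C K.as

instance [HasZeroObject C] : (hoBounded C).ContainsZero where
  exists_zero := ⟨(HomotopyCategory.quotient _ _).obj 0, Functor.map_isZero _ (isZero_zero _),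
    0, 0, (inferInstance : (0 : CochainComplex C ℤ).IsStrictlyGE 0),
    (inferInstance : (0 : CochainComplex C ℤ).IsStrictlyLE 0)⟩

instance : (hoBounded C).IsStableUnderShift ℤ where
  isStableUnderShiftBy n :=
    { le_shift K hK := by
        obtain ⟨K : CochainComplex _ _, rfl⟩ := K.quotient_obj_surjective
        obtain ⟨a, b, ha, hb⟩ := hK
        change K.IsStrictlyGE a at ha
        change K.IsStrictlyLE b at hb
        rw [ObjectProperty.prop_shift_iff, HomotopyCategory.shift_quotient_obj]
        exact ⟨a - n, b - n, K.isStrictlyGE_shift a n (a - n) (by lia),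
          K.isStrictlyLE_shift b n (b - n) (by lia)⟩ }

lemma isStrictlyLE_mappingCone [HasBinaryBiproducts C] {K L : CochainComplex C ℤ} (f : K ⟶ L)
    (b₁ b₂ b : ℤ) [K.IsStrictlyLE b₁] [L.IsStrictlyLE b₂] (h₁ : b₁ ≤ b) (h₂ : b₂ ≤ b) :
    (mappingCone f).IsStrictlyLE b := by
  rw [isStrictlyLE_iff]
  intro i hi
  simp only [mappingCone.isZero_X_iff]
  exact ⟨K.isZero_of_isStrictlyLE b₁ _ (by lia), L.isZero_of_isStrictlyLE b₂ _ (by lia)⟩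

instance [HasZeroObject C] [HasBinaryBiproducts C] : (hoBounded C).IsTriangulatedClosed₃ where
  ext₃' T hT h₁ h₂ := by
    obtain ⟨a₁, b₁, ha₁, hb₁⟩ := h₁
    obtain ⟨a₂, b₂, ha₂, hb₂⟩ := h₂
    obtain ⟨f : T.obj₁.as ⟶ T.obj₂.as, hf⟩ :=
      (HomotopyCategory.quotient _ _).map_surjective T.mor₁
    refine ⟨(HomotopyCategory.quotient _ _).obj (mappingCone f), ?_,
      ⟨Triangle.π₃.mapIso (isoTriangleOfIso₁₂ T _ hT
        (HomotopyCategory.mappingCone_triangleh_distinguished f)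
        (Iso.refl _) (Iso.refl _) ?_)⟩⟩
    · exact ⟨min (a₁ - 1) a₂, max b₁ b₂,
        isStrictlyGE_mappingCone f a₁ a₂ _ (by simp) (by simp),
        isStrictlyLE_mappingCone f b₁ b₂ _ (by simp) (by simp)⟩
    · exact (Category.comp_id _).trans (hf.symm.trans (Category.id_comp _).symm)

instance [HasZeroObject C] [HasBinaryBiproducts C] : (hoBounded C).IsTriangulated where
  toIsTriangulatedClosed₂ := .of_isTriangulatedClosed₃

variable (C) in
/-- The bounded homotopy category, i.e. the homotopy category `H⁰` of the dg category of bounded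
complexes, with its triangulated structure. -/
abbrev BoundedHomotopyCategory := (hoBounded C).FullSubcategory

end Complexes

/-- A semi-orthogonal decomposition `⟨A i | i ∈ I⟩` of a triangulated category, for an index
set `I` ordered by `r`: the `A i` are full triangulated subcategories (up to isomorphism), there
are no nonzero morphisms from `A j` to `A i` for `i < j`, and the smallest strictly full
triangulated subcategory that contains all the `A i` is everything. -/
structure IsSemiorthogonalDecomposition {𝒯 : Type w} [Category.{v} 𝒯] [HasZeroObject 𝒯]
    [HasShift 𝒯 ℤ] [Preadditive 𝒯] [∀ n : ℤ, (shiftFunctor 𝒯 n).Additive] [Pretriangulated 𝒯]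
    {I : Type*} (r : I → I → Prop) (A : I → ObjectProperty 𝒯) : Prop where
  isTriangulated (i : I) : (A i).IsTriangulated
  hom_eq_zero (i j : I) (hij : r i j) (X Y : 𝒯) (hX : A j X) (hY : A i Y) (f : X ⟶ Y) : f = 0
  generate (Q : ObjectProperty 𝒯) (hQ : Q.IsTriangulated) (hQ' : Q.IsClosedUnderIsomorphisms)
    (hA : ∀ i, A i ≤ Q) (X : 𝒯) : Q X

/-! ### Finite locally free modules -/

section Modules

open Scheme.Modules

/-- `M` is finite locally free: every point has an open neighbourhood `U` such that `M` restricted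
to `U` is isomorphic to `𝒪_U ^ n` for some natural number `n`. -/
def IsFiniteLocallyFree {X : Scheme.{u}} : ObjectProperty X.Modules := fun M =>
  ∀ x : X, ∃ (U : X.Opens) (_ : x ∈ U) (n : ℕ),
    Nonempty ((restrictFunctor U.ι).obj M ≅ SheafOfModules.free (ULift.{u} (Fin n)))

/-- The structure sheaf as a module over itself. -/
def structureModule (X : Scheme.{u}) : X.Modules := SheafOfModules.unit X.ringCatSheaf

/-- The free module on a type. -/
def free (X : Scheme.{u}) (I : Type u) : X.Modules := ∐ (fun _ : I => structureModule X)

def restrictFreeIso {X Y : Scheme.{u}} (f : X ⟶ Y) [IsOpenImmersion f] (I : Type u) :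
    (restrictFunctor f).obj (free Y I) ≅ free X I :=
  PreservesCoproduct.iso (restrictFunctor f) _ ≪≫ Sigma.mapIso (fun _ => restrictUnitIso f)

def freeι (X : Scheme.{u}) {I : Type u} (i : I) : structureModule X ⟶ free X I :=
  Sigma.ι (fun _ : I => structureModule X) i

def freeDesc {X : Scheme.{u}} {I : Type u} {M : X.Modules} (f : I → (structureModule X ⟶ M)) :
    free X I ⟶ M := Limits.Sigma.desc f

@[simp]
lemma freeι_desc {X : Scheme.{u}} {I : Type u} {M : X.Modules} (f : I → (structureModule X ⟶ M))
    (i : I) : freeι X i ≫ freeDesc f = f i := Limits.Sigma.ι_desc f i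

@[simp]
lemma freeι_desc_assoc {X : Scheme.{u}} {I : Type u} {M N : X.Modules}
    (f : I → (structureModule X ⟶ M)) (i : I) (h : M ⟶ N) :
    freeι X i ≫ freeDesc f ≫ h = f i ≫ h := by rw [← Category.assoc, freeι_desc]

lemma free_hom_ext {X : Scheme.{u}} {I : Type u} {M : X.Modules} {f g : free X I ⟶ M}
    (h : ∀ i, freeι X i ≫ f = freeι X i ≫ g) : f = g := Limits.Sigma.hom_ext _ _ h

def freeBiprod (X : Scheme.{u}) (I J : Type u) : free X I ⊞ free X J ≅ free X (I ⊕ J) where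
  hom := biprod.desc (freeDesc fun i => freeι X (Sum.inl i)) (freeDesc fun i => freeι X (Sum.inr i))
  inv := freeDesc (Sum.elim (fun i => freeι X i ≫ biprod.inl) (fun i => freeι X i ≫ biprod.inr))
  hom_inv_id := by
    apply biprod.hom_ext' <;> apply free_hom_ext <;> intro i <;> simp
  inv_hom_id := by
    apply free_hom_ext
    rintro (i | i) <;> simp

def freeCongr (X : Scheme.{u}) {I J : Type u} (e : I ≃ J) : free X I ≅ free X J where
  hom := freeDesc fun i => freeι X (e i)
  inv := freeDesc fun i => freeι X (e.symm i)
  hom_inv_id := by apply free_hom_ext; simp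
  inv_hom_id := by apply free_hom_ext; simp

def restrictLeIso {X : Scheme.{u}} {M : X.Modules} {U V : X.Opens} (h : U ≤ V) {I : Type u}
    (e : (restrictFunctor V.ι).obj M ≅ free _ I) : (restrictFunctor U.ι).obj M ≅ free _ I :=
  (restrictFunctorCongr (X.homOfLE_ι h)).symm.app M ≪≫ (restrictFunctorComp _ _).app M ≪≫
    (restrictFunctor (X.homOfLE h)).mapIso e ≪≫ restrictFreeIso _ _

instance {X Y : Scheme.{u}} (f : X ⟶ Y) [IsOpenImmersion f] : (restrictFunctor f).Additive :=
  Functor.additive_of_iso (restrictFunctorIsoPullback f).symm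

lemma isFiniteLocallyFree_biprod {X : Scheme.{u}} {M N : X.Modules} (hM : IsFiniteLocallyFree M)
    (hN : IsFiniteLocallyFree N) : IsFiniteLocallyFree (M ⊞ N) := by
  intro x
  obtain ⟨U, hU, n, ⟨e⟩⟩ := hM x
  obtain ⟨V, hV, m, ⟨e'⟩⟩ := hN x
  have := preservesBinaryBiproducts_of_preservesBinaryCoproducts (restrictFunctor (U ⊓ V).ι)
  exact ⟨U ⊓ V, ⟨hU, hV⟩, n + m, ⟨(restrictFunctor _).mapBiprod _ _ ≪≫
    biprod.mapIso (restrictLeIso inf_le_left e) (restrictLeIso inf_le_right e') ≪≫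
    freeBiprod _ _ _ ≪≫
    freeCongr _ ((Equiv.sumCongr Equiv.ulift Equiv.ulift).trans
      (finSumFinEquiv.trans Equiv.ulift.symm))⟩⟩

lemma isFiniteLocallyFree_of_isZero {X : Scheme.{u}} {M : X.Modules} (hM : IsZero M) :
    IsFiniteLocallyFree M := by
  intro x
  refine ⟨⊤, trivial, 0, ⟨((restrictFunctor _).map_isZero hM).iso ?_⟩⟩
  exact (IsZero.iff_id_eq_zero (free _ _)).2 (free_hom_ext fun i => i.down.elim0)

/-- The category of finite locally free `𝒪_X`-modules. -/
abbrev VectorBundle (X : Scheme.{u}) := (IsFiniteLocallyFree (X := X)).FullSubcategory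

/-! ### Equivariant modules -/

/-- For `φ : f^* M ⟶ g^* N`, the pulled back morphism `h^* φ : (h ≫ f)^* M ⟶ (h ≫ g)^* N`. -/
def pullHom {X Y Z : Scheme.{u}} (h : Y ⟶ Z) {f g : Z ⟶ X} {M N : X.Modules}
    (φ : (Scheme.Modules.pullback f).obj M ⟶ (Scheme.Modules.pullback g).obj N) {a b : Y ⟶ X} (ha : h ≫ f = a)
    (hb : h ≫ g = b) : (Scheme.Modules.pullback a).obj M ⟶ (Scheme.Modules.pullback b).obj N :=
  (pullbackCongr ha).inv.app M ≫ (pullbackComp h f).inv.app M ≫ (Scheme.Modules.pullback h).map φ ≫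
    (pullbackComp h g).hom.app N ≫ (pullbackCongr hb).hom.app N

section
variable {X Y Z : Scheme.{u}} (h : Y ⟶ Z) {f g : Z ⟶ X} {a b : Y ⟶ X} (ha : h ≫ f = a)
    (hb : h ≫ g = b)

lemma pullHom_add {M N : X.Modules}
    (φ ψ : (Scheme.Modules.pullback f).obj M ⟶ (Scheme.Modules.pullback g).obj N) :
    pullHom h (φ + ψ) ha hb = pullHom h φ ha hb + pullHom h ψ ha hb := by
  simp only [pullHom, Functor.map_add, Preadditive.add_comp, Preadditive.comp_add]

lemma pullHom_naturality {M M' N N' : X.Modules}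
    (φ : (Scheme.Modules.pullback f).obj M ⟶ (Scheme.Modules.pullback g).obj N)
    (p : M' ⟶ M) (q : N ⟶ N') :
    pullHom h ((Scheme.Modules.pullback f).map p ≫ φ ≫ (Scheme.Modules.pullback g).map q) ha hb =
      (Scheme.Modules.pullback a).map p ≫ pullHom h φ ha hb ≫
        (Scheme.Modules.pullback b).map q := by
  subst ha hb
  simp only [pullHom, Functor.map_comp, Category.assoc]
  have h1 := (pullbackComp h f).inv.naturality p
  have h2 := (pullbackComp h g).hom.naturality q
  have h3 := (pullbackCongr (rfl : h ≫ f = h ≫ f)).inv.naturality p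
  have h4 := (pullbackCongr (rfl : h ≫ g = h ≫ g)).hom.naturality q
  dsimp at h1 h2 h3 h4
  rw [reassoc_of% h3, reassoc_of% h1]
  simp only [← h4]
  rw [reassoc_of% h2]
end

end Modules

section Equivariant

variable {S : Scheme.{u}} (G X : Over S) [GrpObj G] [ModObj G X]

/-- The action map `G × X ⟶ X`, `(g, x) ↦ g x`, where all products are over `S`. -/
abbrev actMap : G ⊗ X ⟶ X := γ[G, X]

/-- The morphism of schemes underlying the action map. -/
abbrev actLeft : (G ⊗ X).left ⟶ X.left := (actMap G X).left

/-- The morphism of schemes underlying the projection `(g, x) ↦ x`. -/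
abbrev projLeft (G X : Over S) : (G ⊗ X).left ⟶ X.left := (snd G X).left

/-- The morphism `(g, g', x) ↦ (g g', x)`. -/
abbrev cocycleMul (G X : Over S) [GrpObj G] : (G ⊗ G) ⊗ X ⟶ G ⊗ X := μ[G] ▷ X

/-- The morphism `(g, g', x) ↦ (g, g' x)`. -/
abbrev cocycleAct : (G ⊗ G) ⊗ X ⟶ G ⊗ X := (α_ G G X).hom ≫ G ◁ actMap G X

/-- The morphism `(g, g', x) ↦ (g', x)`. -/
abbrev cocycleProj (G X : Over S) : (G ⊗ G) ⊗ X ⟶ G ⊗ X := (α_ G G X).hom ≫ snd G (G ⊗ X)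

lemma cocycleAct_actMap :
    (cocycleAct G X).left ≫ actLeft G X = (cocycleMul G X).left ≫ actLeft G X := by
  simp only [← Over.comp_left]
  congr 1
  rw [Category.assoc]
  exact (ModObj.mul_smul (M := G) X).symm

lemma cocycleProj_actMap :
    (cocycleProj G X).left ≫ actLeft G X = (cocycleAct G X).left ≫ projLeft G X := by
  simp only [← Over.comp_left]
  congr 1
  simp

lemma cocycleProj_projLeft (G X : Over S) [GrpObj G] :
    (cocycleProj G X).left ≫ projLeft G X = (cocycleMul G X).left ≫ projLeft G X := by
  simp only [← Over.comp_left]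
  congr 1
  simp

/-- Pullback of modules along the action map `G × X ⟶ X`. -/
abbrev actPull : X.left.Modules ⥤ (G ⊗ X).left.Modules := Scheme.Modules.pullback (actLeft G X)

/-- Pullback of modules along the projection `G × X ⟶ X`. -/
abbrev projPull (G X : Over S) : X.left.Modules ⥤ (G ⊗ X).left.Modules := Scheme.Modules.pullback (projLeft G X)

/-- A `G`-equivariant `𝒪_X`-module: a module `F` with an isomorphism `φ` between its pullbacks along
the action and the projection `G × X ⟶ X`, that satisfies the cocycle condition on `G × G × X`.
On points, `φ` consists of isomorphisms `F_{g x} ⟶ F_x`, and the cocycle condition says that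
`F_{g g' x} ⟶ F_x` is the composition of `F_{g g' x} ⟶ F_{g' x}` and `F_{g' x} ⟶ F_x`. -/
structure EquivariantModule where
  obj : X.left.Modules
  φ : (actPull G X).obj obj ≅ (projPull G X).obj obj
  cocycle : pullHom (cocycleMul G X).left φ.hom rfl rfl =
    pullHom (cocycleAct G X).left φ.hom (cocycleAct_actMap G X) rfl ≫
      pullHom (cocycleProj G X).left φ.hom (cocycleProj_actMap G X) (cocycleProj_projLeft G X)

namespace EquivariantModule
variable {G X}

/-- A morphism of modules that is compatible with the equivariant structures. -/
@[ext]
structure Hom (M N : EquivariantModule G X) where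
  hom : M.obj ⟶ N.obj
  comm : (actPull G X).map hom ≫ N.φ.hom = M.φ.hom ≫ (projPull G X).map hom := by cat_disch

instance : Category (EquivariantModule G X) where
  Hom := Hom
  id M := { hom := 𝟙 _ }
  comp f g := { hom := f.hom ≫ g.hom, comm := by simp only [Functor.map_comp, Category.assoc, g.comm, reassoc_of% f.comm] }
  id_comp f := by apply Hom.ext; simp
  comp_id f := by apply Hom.ext; simp
  assoc f g h := by apply Hom.ext; simp

variable {M N P : EquivariantModule G X}

@[ext] lemma hom_ext {f g : M ⟶ N} (h : f.hom = g.hom) : f = g := Hom.ext h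
@[simp] lemma id_hom : (𝟙 M : M ⟶ M).hom = 𝟙 M.obj := rfl
@[simp] lemma comp_hom (f : M ⟶ N) (g : N ⟶ P) : (f ≫ g).hom = f.hom ≫ g.hom := rfl

instance : Zero (M ⟶ N) := ⟨{ hom := 0, comm := by simp }⟩
instance : Add (M ⟶ N) := ⟨fun f g => 
  { hom := f.hom + g.hom
    comm := by simp [Functor.map_add, f.comm, g.comm] }⟩
instance : Neg (M ⟶ N) := ⟨fun f => 
  { hom := -f.hom
    comm := by simp [Functor.map_neg, f.comm] }⟩

@[simp] lemma zero_hom : (0 : M ⟶ N).hom = 0 := rfl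
@[simp] lemma add_hom (f g : M ⟶ N) : (f + g).hom = f.hom + g.hom := rfl
@[simp] lemma neg_hom (f : M ⟶ N) : (-f).hom = -f.hom := rfl

instance : AddCommGroup (M ⟶ N) where
  add_assoc f g h := by ext1; simp [add_assoc]
  zero_add f := by ext1; simp
  add_zero f := by ext1; simp
  neg_add_cancel f := by ext1; simp
  add_comm f g := by ext1; simp [add_comm]
  nsmul := nsmulRec
  zsmul := zsmulRec

instance : Preadditive (EquivariantModule G X) where
  add_comp _ _ _ f f' g := by ext1; simp
  comp_add _ _ _ f g g' := by ext1; simp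

variable (G X) in
/-- The functor forgetting the equivariant structure. -/
@[simps]
def forget : EquivariantModule G X ⥤ X.left.Modules where
  obj M := M.obj
  map f := f.hom

instance : (forget G X).Additive where
instance : (forget G X).Faithful where
  map_injective h := hom_ext h

variable (G X) in
/-- The zero equivariant module. -/
def zero : EquivariantModule G X where
  obj := 0
  φ := ((actPull G X).map_isZero (isZero_zero _)).iso ((projPull G X).map_isZero (isZero_zero _))
  cocycle := ((Functor.map_isZero _ (isZero_zero _))).eq_of_src _ _

instance : HasZeroObject (EquivariantModule G X) where
  zero := ⟨zero G X, by
    rw [IsZero.iff_id_eq_zero]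
    ext1
    exact (isZero_zero _).eq_of_src _ _⟩

/-- The structure isomorphism of the direct sum. -/
def biprodHom (M N : EquivariantModule G X) :
    (actPull G X).obj (M.obj ⊞ N.obj) ⟶ (projPull G X).obj (M.obj ⊞ N.obj) :=
  (actPull G X).map biprod.fst ≫ M.φ.hom ≫ (projPull G X).map biprod.inl +
    (actPull G X).map biprod.snd ≫ N.φ.hom ≫ (projPull G X).map biprod.inr

/-- The inverse structure isomorphism of the direct sum. -/
def biprodInv (M N : EquivariantModule G X) :
    (projPull G X).obj (M.obj ⊞ N.obj) ⟶ (actPull G X).obj (M.obj ⊞ N.obj) :=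
  (projPull G X).map biprod.fst ≫ M.φ.inv ≫ (actPull G X).map biprod.inl +
    (projPull G X).map biprod.snd ≫ N.φ.inv ≫ (actPull G X).map biprod.inr

lemma map_biprod_aux {A B : Type*} [Category* A] [Category* B] [Preadditive A] [Preadditive B]
    (F : A ⥤ B) [F.Additive] (a b : A) [HasBinaryBiproduct a b] :
    F.map (biprod.inl : a ⟶ a ⊞ b) ≫ F.map biprod.fst = 𝟙 _ ∧
    F.map (biprod.inl : a ⟶ a ⊞ b) ≫ F.map biprod.snd = 0 ∧
    F.map (biprod.inr : b ⟶ a ⊞ b) ≫ F.map biprod.fst = 0 ∧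
    F.map (biprod.inr : b ⟶ a ⊞ b) ≫ F.map biprod.snd = 𝟙 _ ∧
    F.map (biprod.fst : a ⊞ b ⟶ a) ≫ F.map biprod.inl +
      F.map (biprod.snd : a ⊞ b ⟶ b) ≫ F.map biprod.inr = 𝟙 _ := by
  refine ⟨?_, ?_, ?_, ?_, ?_⟩ <;> simp only [← Functor.map_comp, ← Functor.map_add] <;> simp

/-- The direct sum of two equivariant modules. -/
def biprodObj (M N : EquivariantModule G X) : EquivariantModule G X where
  obj := M.obj ⊞ N.obj
  φ :=
    { hom := biprodHom M N
      inv := biprodInv M N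
      hom_inv_id := by
        obtain ⟨h1, h2, h3, h4, h5⟩ := map_biprod_aux (projPull G X) M.obj N.obj
        obtain ⟨-, -, -, -, h6⟩ := map_biprod_aux (actPull G X) M.obj N.obj
        simp [biprodHom, biprodInv, reassoc_of% h1, reassoc_of% h2, reassoc_of% h3, reassoc_of% h4, h6]
      inv_hom_id := by
        obtain ⟨h1, h2, h3, h4, h5⟩ := map_biprod_aux (actPull G X) M.obj N.obj
        obtain ⟨-, -, -, -, h6⟩ := map_biprod_aux (projPull G X) M.obj N.obj
        simp [biprodHom, biprodInv, reassoc_of% h1, reassoc_of% h2, reassoc_of% h3, reassoc_of% h4, h6] }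
  cocycle := by
    simp only [biprodHom, pullHom_add, pullHom_naturality, Preadditive.add_comp,
      Preadditive.comp_add, Category.assoc]
    obtain ⟨h1, h2, h3, h4, -⟩ := map_biprod_aux
      (Scheme.Modules.pullback ((cocycleAct G X).left ≫ projLeft G X)) M.obj N.obj
    rw [reassoc_of% h1, reassoc_of% h2, reassoc_of% h3, reassoc_of% h4, M.cocycle, N.cocycle]
    simp only [zero_comp, comp_zero, add_zero, zero_add, Category.assoc]

/-- The direct sum with its inclusions and projections. -/
def biprodBicone (M N : EquivariantModule G X) : BinaryBicone M N where
  pt := biprodObj M N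
  fst := ⟨biprod.fst, by
    obtain ⟨h1, h2, h3, h4, h5⟩ := map_biprod_aux (projPull G X) M.obj N.obj
    simp [biprodObj, biprodHom, h1, h3]⟩
  snd := ⟨biprod.snd, by
    obtain ⟨h1, h2, h3, h4, h5⟩ := map_biprod_aux (projPull G X) M.obj N.obj
    simp [biprodObj, biprodHom, h2, h4]⟩
  inl := ⟨biprod.inl, by
    obtain ⟨h1, h2, h3, h4, h5⟩ := map_biprod_aux (actPull G X) M.obj N.obj
    simp [biprodObj, biprodHom, reassoc_of% h1, reassoc_of% h2]⟩
  inr := ⟨biprod.inr, by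
    obtain ⟨h1, h2, h3, h4, h5⟩ := map_biprod_aux (actPull G X) M.obj N.obj
    simp [biprodObj, biprodHom, reassoc_of% h3, reassoc_of% h4]⟩
  inl_fst := by ext1; exact biprod.inl_fst
  inl_snd := by ext1; exact biprod.inl_snd
  inr_fst := by ext1; exact biprod.inr_fst
  inr_snd := by ext1; exact biprod.inr_snd

lemma biprodBicone_total (M N : EquivariantModule G X) :
    (biprodBicone M N).fst ≫ (biprodBicone M N).inl +
      (biprodBicone M N).snd ≫ (biprodBicone M N).inr = 𝟙 _ := by
  ext1
  exact biprod.total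

end EquivariantModule

section VectorBundles

variable {S : Scheme.{u}} (G X : Over S) [GrpObj G] [ModObj G X]

/-- The category of `G`-equivariant finite locally free `𝒪_X`-modules. -/
abbrev EquivariantVectorBundle :=
  ((IsFiniteLocallyFree (X := X.left)).inverseImage (EquivariantModule.forget G X)).FullSubcategory

instance : ((IsFiniteLocallyFree (X := X.left)).inverseImage
    (EquivariantModule.forget G X)).ContainsZero where
  exists_zero := ⟨0, isZero_zero _, isFiniteLocallyFree_of_isZero
    ((EquivariantModule.forget G X).map_isZero (isZero_zero _))⟩

instance : HasBinaryBiproducts (EquivariantVectorBundle G X) where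
  has_binary_biproduct M N := HasBinaryBiproduct.mk
    { bicone :=
        { pt := ⟨M.obj.biprodObj N.obj, isFiniteLocallyFree_biprod M.property N.property⟩
          fst := ObjectProperty.homMk (EquivariantModule.biprodBicone M.obj N.obj).fst
          snd := ObjectProperty.homMk (EquivariantModule.biprodBicone M.obj N.obj).snd
          inl := ObjectProperty.homMk (EquivariantModule.biprodBicone M.obj N.obj).inl
          inr := ObjectProperty.homMk (EquivariantModule.biprodBicone M.obj N.obj).inr
          inl_fst := by ext1; exact (EquivariantModule.biprodBicone M.obj N.obj).inl_fst
          inl_snd := by ext1; exact (EquivariantModule.biprodBicone M.obj N.obj).inl_snd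
          inr_fst := by ext1; exact (EquivariantModule.biprodBicone M.obj N.obj).inr_fst
          inr_snd := by ext1; exact (EquivariantModule.biprodBicone M.obj N.obj).inr_snd }
      isBilimit := isBinaryBilimitOfTotal _ (by
        ext1; exact EquivariantModule.biprodBicone_total M.obj N.obj) }

/-- The functor `Vect^G(X) ⥤ Vect(X)` forgetting the equivariant structure. -/
def forgetEquivariance : EquivariantVectorBundle G X ⥤ VectorBundle X.left :=
  ObjectProperty.lift _ (ObjectProperty.ι _ ⋙ EquivariantModule.forget G X) (fun M => M.property)

instance : (forgetEquivariance G X).Additive where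

/-- The dg category of bounded complexes of finite locally free `𝒪_X`-modules. -/
abbrev SPerf (X : Scheme.{u}) := (boundedComplexes (VectorBundle X)).FullSubcategory

/-- The dg category of bounded complexes of `G`-equivariant finite locally free `𝒪_X`-modules. -/
abbrev SPerfEquivariant := (boundedComplexes (EquivariantVectorBundle G X)).FullSubcategory

end VectorBundles

/-! ### Split tori and weights -/

section Torus

variable {S : Scheme.{u}} {T : Over S} [GrpObj T] {t : ℕ}

variable (T t) in
/-- An isomorphism of the group scheme `T` over `S` with `𝔾ₘ ^ t`, given through the functors of
points: for every `S`-scheme `U` an isomorphism of groups `T(U) ≃ (Γ(U, 𝒪_U)ˣ) ^ t`, natural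
in `U`. A split torus of rank `t` is a group scheme with such an isomorphism. -/
structure TorusSplitting where
  coord (U : Over S) : (U ⟶ T) ≃* (Fin t → Γ(U.left, ⊤)ˣ)
  coord_comp {U V : Over S} (f : V ⟶ U) (g : U ⟶ T) (i : Fin t) :
    coord V (f ≫ g) i = Units.map f.left.appTop.hom.toMonoidHom (coord U g i)

/-- The pullback to `T × X` of the character of `T` of weight `l`, i.e. of the invertible function
`(z₁, …, z_t) ↦ z₁ ^ l₁ ⋯ z_t ^ l_t`. -/
def TorusSplitting.character (e : TorusSplitting T t) (X : Over S) (l : Fin t → ℤ) :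
    Γ((T ⊗ X).left, ⊤)ˣ :=
  ∏ i, e.coord (T ⊗ X) (fst T X) i ^ l i

variable {X : Over S} [ModObj T X]

variable (T X) in
/-- The action of `T` on `X` is trivial: the action map `T × X ⟶ X` is the projection. -/
def IsTrivialAction : Prop := actMap T X = snd T X

/-- An equivariant module (for a trivial action) is concentrated in degree `l` if `T` acts on it
through the character of weight `l`, i.e. if, under the identification of the pullbacks along the
action map and the projection, which coincide, its structure isomorphism is multiplication
by this character. -/
def IsConcentrated (e : TorusSplitting T t) (h : IsTrivialAction T X) (l : Fin t → ℤ)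
    (M : EquivariantModule T X) : Prop :=
  ∀ (U : (T ⊗ X).left.Opens) (s : Γ((actPull T X).obj M.obj, U)),
    M.φ.hom.app U s = (T ⊗ X).left.presheaf.map (homOfLE (le_top : U ≤ ⊤)).op (e.character X l).val •
      ((Scheme.Modules.pullbackCongr (congrArg Over.Hom.left h)).hom.app M.obj).app U s

/-- The bounded complexes of equivariant finite locally free modules that are concentrated
in degree `l`. -/
def weightComplexes (e : TorusSplitting T t) (h : IsTrivialAction T X) (l : Fin t → ℤ) :
    ObjectProperty (CochainComplex (EquivariantVectorBundle T X) ℤ) := fun K =>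
  boundedComplexes _ K ∧ ∀ n, IsConcentrated e h l (K.X n).obj

/-- The full dg subcategory `𝒜_l` of complexes concentrated in degree `l`. -/
abbrev WeightPart (e : TorusSplitting T t) (h : IsTrivialAction T X) (l : Fin t → ℤ) :=
  (weightComplexes e h l).FullSubcategory

/-- The dg functor from `𝒜_l` to `sPerf(X)` that forgets the equivariant structure. -/
def forgetWeightPart (e : TorusSplitting T t) (h : IsTrivialAction T X) (l : Fin t → ℤ) :
    DGFunctor (WeightPart e h l) (SPerf X.left) :=
  mapComplexDG (forgetEquivariance T X) _ _ (by
    rintro K ⟨⟨a, b, ha, hb⟩, -⟩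
    exact ⟨a, b, inferInstance, inferInstance⟩)

/-- `𝒜_l` as a full subcategory of the homotopy category of `sPerf^T(X)`. -/
def hoWeightPart (e : TorusSplitting T t) (h : IsTrivialAction T X) (l : Fin t → ℤ) :
    ObjectProperty (BoundedHomotopyCategory (EquivariantVectorBundle T X)) := fun K =>
  weightComplexes e h l K.obj.as

end Torus

end Equivariant
end TorusPerf
end

/-! For a trivial action an equivariant structure on `M` is a coaction of the group algebra of
`ℤ^t`, and such a coaction is the same as a grading. The proof makes this explicit on sections. Over
an affine open `U` of `X`, the functions on `T × U` are the Laurent polynomials over `Γ(X, U)`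
(`groupAlgebraHom_bijective`). If `M` is moreover free on `U`, the structure isomorphism therefore
sends a section `x` to a finite sum of terms `χ_l n_l`. The cocycle condition reads `∑ χ_l(g) φ(n_l)
= ∑ χ_l(g) χ_l(g') n_l`; comparing coefficients of `χ_l(g)` over the base `T × X` gives `φ(n_l) =
χ_l(g') n_l`, so each `n_l` is homogeneous of weight `l` (`IsFrame.isHomogeneous_of_eq_sum`). Since
`φ` is injective, `x = ∑ n_l` (`IsFrame.exists_isHomogeneous`).

A nonvanishing minor turns the homogeneous components of a frame into a homogeneous frame near any
given point (`exists_homogeneous_frame`). So the weight parts, which are kernels of morphisms of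
modules, are again finite locally free, and by quasi-compactness only finitely many are needed: `M`
is a finite direct sum of them (`exists_weight_decomposition`).

The rest is formal. A linear map between modules of the same weight is automatically equivariant,
whence the equivalence with `sPerf(X)`. A section with two different weights vanishes, because
characters are linearly independent over `𝒪_X`; morphisms preserve weights, so there are none
between different weights. Differentials preserve weights too, so a bounded complex is a finite
direct sum of complexes of pure weight (`exists_complex_decomposition`), which gives generation.
Mapping cones have termwise direct sums as terms, so each weight part is triangulated. The
decomposition is orthogonal in both directions, which is why any total order will do. -/

noncomputable section

namespace TorusPerf

open Scheme.Modules

/-! ### Pulling back functions and sections of modules. -/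

section Sections

variable {X Y Z : Scheme.{u}}

/-- Restriction of sections of a module. -/
def res (M : X.Modules) {U V : X.Opens} (h : V ≤ U) : Γ(M, U) →+ Γ(M, V) :=
  (M.presheaf.map (homOfLE h).op).hom

/-- Restriction of functions. -/
def resO {U V : X.Opens} (h : V ≤ U) : Γ(X, U) →+* Γ(X, V) :=
  (X.presheaf.map (homOfLE h).op).hom

@[simp]
lemma res_self (M : X.Modules) {U : X.Opens} (h : U ≤ U) (s : Γ(M, U)) : res M h s = s := by
  simp [res]

@[simp]
lemma res_res (M : X.Modules) {U V W : X.Opens} (h : V ≤ U) (h' : W ≤ V) (s : Γ(M, U)) :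
    res M h' (res M h s) = res M (h'.trans h) s := by
  simp only [res]
  rw [← AddCommGrpCat.comp_apply, ← Functor.map_comp]
  rfl

@[simp]
lemma resO_self {U : X.Opens} (h : U ≤ U) (s : Γ(X, U)) : resO h s = s := by
  simp [resO]

@[simp]
lemma resO_resO {U V W : X.Opens} (h : V ≤ U) (h' : W ≤ V) (s : Γ(X, U)) :
    resO h' (resO h s) = resO (h'.trans h) s := by
  simp only [resO]
  rw [← CommRingCat.comp_apply, ← Functor.map_comp]
  rfl

lemma res_smul (M : X.Modules) {U V : X.Opens} (h : V ≤ U) (a : Γ(X, U)) (s : Γ(M, U)) :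
    res M h (a • s) = resO h a • res M h s :=
  Scheme.Modules.map_smul M (homOfLE h) a s

lemma app_res {M N : X.Modules} (φ : M ⟶ N) {U V : X.Opens} (h : V ≤ U) (s : Γ(M, U)) :
    φ.app V (res M h s) = res N h (φ.app U s) :=
  ConcreteCategory.congr_hom (φ.mapPresheaf.naturality (homOfLE h).op) s

/-- Pullback of functions. -/
def pbO (f : Y ⟶ X) {U : X.Opens} {V : Y.Opens} (h : V ≤ f ⁻¹ᵁ U) : Γ(X, U) →+* Γ(Y, V) :=
  (f.appLE U V h).hom

@[simp]
lemma resO_pbO (f : Y ⟶ X) {U : X.Opens} {V W : Y.Opens} (h : V ≤ f ⁻¹ᵁ U) (h' : W ≤ V)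
    (a : Γ(X, U)) : resO h' (pbO f h a) = pbO f (h'.trans h) a := by
  simp only [resO, pbO]
  rw [← CommRingCat.comp_apply, Scheme.Hom.appLE_map]

@[simp]
lemma pbO_resO (f : Y ⟶ X) {U U' : X.Opens} {V : Y.Opens} (h' : U' ≤ U) (h : V ≤ f ⁻¹ᵁ U')
    (a : Γ(X, U)) : pbO f h (resO h' a) = pbO f (h.trans (f.preimage_mono h')) a := by
  simp only [resO, pbO]
  rw [← CommRingCat.comp_apply, Scheme.Hom.map_appLE]

@[simp]
lemma pbO_pbO (f : Y ⟶ X) (g : X ⟶ Z) {U : Z.Opens} {V : X.Opens} {W : Y.Opens}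
    (h : V ≤ g ⁻¹ᵁ U) (h' : W ≤ f ⁻¹ᵁ V) (a : Γ(Z, U)) :
    pbO f h' (pbO g h a) = pbO (f ≫ g) (h'.trans (f.preimage_mono h)) a := by
  simp only [pbO]
  rw [← CommRingCat.comp_apply, Scheme.Hom.appLE_comp_appLE]

/-- The unit of the adjunction between pullback and pushforward. -/
def pullUnit (f : Y ⟶ X) (M : X.Modules) :
    M ⟶ (pushforward f).obj ((Scheme.Modules.pullback f).obj M) :=
  (pullbackPushforwardAdjunction f).unit.app M

/-- The pullback of a section of `M` over `U`, as a section of the pullback of `M` over `f⁻¹ U`. -/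
def unitSec (f : Y ⟶ X) (M : X.Modules) (U : X.Opens) :
    Γ(M, U) →+ Γ((Scheme.Modules.pullback f).obj M, f ⁻¹ᵁ U) :=
  ((pullUnit f M).app U).hom

/-- The pullback of a section of `M`, as a section of the pullback of `M`. -/
def psec (f : Y ⟶ X) {M : X.Modules} {U : X.Opens} {V : Y.Opens} (h : V ≤ f ⁻¹ᵁ U) :
    Γ(M, U) →+ Γ((Scheme.Modules.pullback f).obj M, V) :=
  (res _ h).comp (unitSec f M U)

lemma psec_def (f : Y ⟶ X) {M : X.Modules} {U : X.Opens} {V : Y.Opens} (h : V ≤ f ⁻¹ᵁ U)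
    (s : Γ(M, U)) : psec f h s = res _ h (unitSec f M U s) := rfl

lemma psec_le_rfl (f : Y ⟶ X) {M : X.Modules} {U : X.Opens} (h : f ⁻¹ᵁ U ≤ f ⁻¹ᵁ U)
    (s : Γ(M, U)) : psec f h s = unitSec f M U s := res_self _ _ _

lemma res_psec (f : Y ⟶ X) {M : X.Modules} {U : X.Opens} {V W : Y.Opens} (h : V ≤ f ⁻¹ᵁ U)
    (h' : W ≤ V) (s : Γ(M, U)) : res _ h' (psec f h s) = psec f (h'.trans h) s := by
  simp [psec_def]

lemma unitSec_res (f : Y ⟶ X) {M : X.Modules} {U U' : X.Opens} (h' : U' ≤ U) (s : Γ(M, U)) :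
    unitSec f M U' (res M h' s) = res _ (f.preimage_mono h') (unitSec f M U s) :=
  app_res (pullUnit f M) h' s

lemma psec_res (f : Y ⟶ X) {M : X.Modules} {U U' : X.Opens} {V : Y.Opens} (h' : U' ≤ U)
    (h : V ≤ f ⁻¹ᵁ U') (s : Γ(M, U)) :
    psec f h (res M h' s) = psec f (h.trans (f.preimage_mono h')) s := by
  rw [psec_def, unitSec_res, res_res, psec_def]

lemma unitSec_smul (f : Y ⟶ X) {M : X.Modules} {U : X.Opens} (a : Γ(X, U)) (s : Γ(M, U)) :
    unitSec f M U (a • s) = f.app U a • unitSec f M U s :=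
  (pullUnit f M).app_smul a s

lemma psec_smul (f : Y ⟶ X) {M : X.Modules} {U : X.Opens} {V : Y.Opens} (h : V ≤ f ⁻¹ᵁ U)
    (a : Γ(X, U)) (s : Γ(M, U)) : psec f h (a • s) = pbO f h a • psec f h s := by
  rw [psec_def, unitSec_smul, res_smul]
  rfl

lemma app_unitSec (f : Y ⟶ X) {M N : X.Modules} (φ : M ⟶ N) {U : X.Opens} (s : Γ(M, U)) :
    ((Scheme.Modules.pullback f).map φ).app (f ⁻¹ᵁ U) (unitSec f M U s) =
      unitSec f N U (φ.app U s) :=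
  (congr(($((pullbackPushforwardAdjunction f).unit.naturality φ)).app U s)).symm

lemma app_psec (f : Y ⟶ X) {M N : X.Modules} (φ : M ⟶ N) {U : X.Opens} {V : Y.Opens}
    (h : V ≤ f ⁻¹ᵁ U) (s : Γ(M, U)) :
    ((Scheme.Modules.pullback f).map φ).app V (psec f h s) = psec f h (φ.app U s) := by
  rw [psec_def, app_res, app_unitSec, psec_def]

/-- By adjunction a morphism out of a pullback is determined by its values on pulled back sections.
Identities between structure isomorphisms can thus be checked on `psec`. -/
lemma pullback_hom_ext (f : Y ⟶ X) {M : X.Modules} {N : Y.Modules}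
    {α β : (Scheme.Modules.pullback f).obj M ⟶ N}
    (h : ∀ (U : X.Opens) (s : Γ(M, U)), α.app (f ⁻¹ᵁ U) (psec f le_rfl s) =
      β.app (f ⁻¹ᵁ U) (psec f le_rfl s)) : α = β := by
  apply ((pullbackPushforwardAdjunction f).homEquiv _ _).injective
  ext U s
  have := h U s
  rw [psec_le_rfl] at this
  rw [Adjunction.homEquiv_unit, Adjunction.homEquiv_unit]
  exact this

lemma pullbackCongr_psec {f g : Y ⟶ X} (hfg : f = g) {M : X.Modules} {U : X.Opens} {V : Y.Opens}
    (h : V ≤ f ⁻¹ᵁ U) (s : Γ(M, U)) :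
    ((pullbackCongr hfg).hom.app M).app V (psec f h s) = psec g (hfg ▸ h) s := by
  subst hfg
  rfl

lemma pullbackCongr_inv_psec {f g : Y ⟶ X} (hfg : f = g) {M : X.Modules} {U : X.Opens}
    {V : Y.Opens} (h : V ≤ g ⁻¹ᵁ U) (s : Γ(M, U)) :
    ((pullbackCongr hfg).inv.app M).app V (psec g h s) = psec f (hfg ▸ h) s := by
  subst hfg
  rfl

/-- The comparison isomorphism is conjugate to the one for pushforwards, which does nothing on
sections, so it carries the unit for `f ≫ g` to the composite of the two units. -/
lemma pullbackComp_inv_psec (f : Y ⟶ X) (g : X ⟶ Z) {M : Z.Modules} {U : Z.Opens} {V : X.Opens}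
    {W : Y.Opens} (h : V ≤ g ⁻¹ᵁ U) (h' : W ≤ f ⁻¹ᵁ V) (s : Γ(M, U)) :
    ((pullbackComp f g).inv.app M).app W (psec (f ≫ g) (h'.trans (f.preimage_mono h)) s) =
      psec f h' (psec g h s) := by
  have key := unit_conjugateEquiv ((pullbackPushforwardAdjunction g).comp
    (pullbackPushforwardAdjunction f)) (pullbackPushforwardAdjunction (f ≫ g))
    (pullbackComp f g).inv M
  rw [conjugateEquiv_pullbackComp_inv] at key
  have h1 : ((pullbackComp f g).inv.app M).app (f ⁻¹ᵁ g ⁻¹ᵁ U) (unitSec (f ≫ g) M U s) =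
      unitSec f _ (g ⁻¹ᵁ U) (unitSec g M U s) := by
    rw [Adjunction.comp_unit_app] at key
    exact congr(($key).app U s).symm
  rw [psec_def, psec_def, psec_def, unitSec_res, res_res, ← h1]
  exact app_res ((pullbackComp f g).inv.app M) (h'.trans (f.preimage_mono h)) _

lemma pullbackComp_psec (f : Y ⟶ X) (g : X ⟶ Z) {M : Z.Modules} {U : Z.Opens} {V : X.Opens}
    {W : Y.Opens} (h : V ≤ g ⁻¹ᵁ U) (h' : W ≤ f ⁻¹ᵁ V) (s : Γ(M, U)) :
    ((pullbackComp f g).hom.app M).app W (psec f h' (psec g h s)) =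
      psec (f ≫ g) (h'.trans (f.preimage_mono h)) s := by
  rw [← pullbackComp_inv_psec]
  exact congr(($((pullbackComp f g).inv_hom_id_app M)).app W _)

lemma pullHom_psec (h : Y ⟶ Z) {f g : Z ⟶ X} {M N : X.Modules}
    (φ : (Scheme.Modules.pullback f).obj M ⟶ (Scheme.Modules.pullback g).obj N) {a b : Y ⟶ X}
    (ha : h ≫ f = a) (hb : h ≫ g = b) {U : X.Opens} {V : Z.Opens} {W : Y.Opens}
    (hV : V ≤ f ⁻¹ᵁ U) (hW : W ≤ h ⁻¹ᵁ V) (s : Γ(M, U)) (hWa : W ≤ a ⁻¹ᵁ U) :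
    (pullHom h φ ha hb).app W (psec a hWa s) =
      ((pullbackComp h g).hom.app N ≫ (pullbackCongr hb).hom.app N).app W
        (psec h hW (φ.app V (psec f hV s))) := by
  subst ha hb
  rw [pullHom]
  have e1 := pullbackCongr_inv_psec (rfl : h ≫ f = h ≫ f) (hW.trans (h.preimage_mono hV)) s
  have e2 := pullbackComp_inv_psec h f hV hW s
  have e3 := app_psec h φ hW (psec f hV s)
  rw [← e3, ← e2, ← e1]
  rfl

/-- If `φ` is known on a pulled back section, then so is its base change: only the coefficients `r
i` get pulled back. This is how the cocycle condition is evaluated on sections. -/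
lemma pullHom_psec_sum (h : Y ⟶ Z) {f g : Z ⟶ X} {M N : X.Modules}
    (φ : (Scheme.Modules.pullback f).obj M ⟶ (Scheme.Modules.pullback g).obj N) {a b : Y ⟶ X}
    (ha : h ≫ f = a) (hb : h ≫ g = b) {U U' : X.Opens} {V : Z.Opens} {W : Y.Opens}
    (hV : V ≤ f ⁻¹ᵁ U) (hV' : V ≤ g ⁻¹ᵁ U') (hW : W ≤ h ⁻¹ᵁ V) (s : Γ(M, U)) {J : Type*}
    (F : Finset J) (r : J → Γ(Z, V)) (n : J → Γ(N, U'))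
    (hs : φ.app V (psec f hV s) = ∑ i ∈ F, r i • psec g hV' (n i))
    (hWa : W ≤ a ⁻¹ᵁ U) (hWb : W ≤ b ⁻¹ᵁ U') :
    (pullHom h φ ha hb).app W (psec a hWa s) = ∑ i ∈ F, pbO h hW (r i) • psec b hWb (n i) := by
  subst ha hb
  rw [pullHom_psec h φ rfl rfl hV hW _ hWa, hs, map_sum, map_sum]
  refine Finset.sum_congr rfl fun i _ => ?_
  rw [psec_smul, Hom.app_smul]
  congr 1
  have e1 := pullbackComp_psec h g hV' hW (n i)
  have e2 := pullbackCongr_psec (rfl : h ≫ g = h ≫ g) (hW.trans (h.preimage_mono hV')) (n i)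
  rw [← e2, ← e1]
  rfl

end Sections
end TorusPerf
end

noncomputable section

namespace TorusPerf

open Scheme.Modules

/-! ### Local bases of modules and their pullbacks. -/

section Frames

variable {X Y Z : Scheme.{u}}

/-- Finitely many sections over `U` form a frame if they are a basis over every smaller open. -/
def IsFrame {M : X.Modules} {U : X.Opens} {I : Type*} [Fintype I] (s : I → Γ(M, U)) : Prop :=
  ∀ (V : X.Opens) (h : V ≤ U),
    Function.Bijective (fun a : I → Γ(X, V) => ∑ i, a i • res M h (s i))

variable {M N : X.Modules} {U V : X.Opens} {I : Type*} [Fintype I]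

lemma IsFrame.res {s : I → Γ(M, U)} (hs : IsFrame s) (h : V ≤ U) :
    IsFrame (fun i => res M h (s i)) := by
  intro W hW
  simpa using hs W (hW.trans h)

lemma IsFrame.exists_eq_sum {s : I → Γ(M, U)} (hs : IsFrame s) (h : V ≤ U) (b : Γ(M, V)) :
    ∃ a : I → Γ(X, V), b = ∑ i, a i • TorusPerf.res M h (s i) := by
  obtain ⟨a, ha⟩ := (hs V h).2 b
  exact ⟨a, ha.symm⟩

lemma IsFrame.eq_zero {s : I → Γ(M, U)} (hs : IsFrame s) (h : V ≤ U) (a : I → Γ(X, V))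
    (ha : ∑ i, a i • TorusPerf.res M h (s i) = 0) (i : I) : a i = 0 := by
  have := @(hs V h).1 a 0 (by simpa using ha)
  exact congrFun this i

lemma isFrame_of {s : I → Γ(M, U)}
    (h₁ : ∀ (V : X.Opens) (h : V ≤ U) (a : I → Γ(X, V)), ∑ i, a i • res M h (s i) = 0 → a = 0)
    (h₂ : ∀ (V : X.Opens) (h : V ≤ U) (b : Γ(M, V)), ∃ a : I → Γ(X, V),
      ∑ i, a i • res M h (s i) = b) : IsFrame s := by
  intro V h
  refine ⟨fun a b hab => ?_, h₂ V h⟩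
  rw [← sub_eq_zero]
  apply h₁ V h
  simp only [Pi.sub_apply, sub_smul, Finset.sum_sub_distrib]
  exact sub_eq_zero.2 hab

/-- The map on the left is `φ.app V` after the coordinates given by `s`. It serves both to transport
frames along isomorphisms and to recognise isomorphisms by their effect on a frame. -/
lemma IsFrame.bijective_comp {s : I → Γ(M, U)} (hs : IsFrame s) (φ : M ⟶ N)
    (h : V ≤ U) : (Function.Bijective fun a : I → Γ(X, V) => 
      ∑ i, a i • TorusPerf.res N h (φ.app U (s i))) ↔ Function.Bijective (φ.app V) := by
  have : (fun a : I → Γ(X, V) => ∑ i, a i • TorusPerf.res N h (φ.app U (s i))) =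
      (φ.app V) ∘ (fun a : I → Γ(X, V) => ∑ i, a i • TorusPerf.res M h (s i)) := by
    ext a
    simp only [Function.comp_apply, map_sum, Hom.app_smul, app_res]
  rw [this]
  exact Function.Bijective.of_comp_iff _ (hs V h)

lemma bijective_app_of_isIso (φ : M ⟶ N) [IsIso φ] (V : X.Opens) :
    Function.Bijective (φ.app V) :=
  ConcreteCategory.bijective_of_isIso (φ.app V)

lemma isIso_of_bijective_app (φ : M ⟶ N) (h : ∀ V, Function.Bijective (φ.app V)) : IsIso φ := by
  rw [Hom.isIso_iff_isIso_app]
  exact fun V => (ConcreteCategory.isIso_iff_bijective _).2 (h V)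

lemma IsFrame.map {s : I → Γ(M, U)} (hs : IsFrame s) (φ : M ⟶ N) [IsIso φ] :
    IsFrame (fun i => φ.app U (s i)) := fun V h =>
  (hs.bijective_comp φ h).2 (bijective_app_of_isIso φ V)

lemma IsFrame.hom_ext {s : I → Γ(M, ⊤)} (hs : IsFrame s) {φ ψ : M ⟶ N}
    (h : ∀ i, φ.app ⊤ (s i) = ψ.app ⊤ (s i)) : φ = ψ := by
  ext V b
  obtain ⟨a, rfl⟩ := hs.exists_eq_sum le_top b
  change φ.app V _ = ψ.app V _
  simp only [map_sum, Hom.app_smul, app_res, h]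

variable (X) in
/-- The section `1` of the structure sheaf. -/
def oneSec (U : X.Opens) : Γ(structureModule X, U) := (1 : Γ(X, U))

lemma res_oneSec (h : V ≤ U) : res _ h (oneSec X U) = oneSec X V :=
  map_one (resO h)

lemma smul_oneSec_injective : Function.Injective fun a : Γ(X, U) => a • oneSec X U := by
  intro a b h
  change a * 1 = b * 1 at h
  simpa using h

lemma exists_smul_oneSec (b : Γ(structureModule X, U)) : ∃ a : Γ(X, U), a • oneSec X U = b :=
  ⟨b, mul_one (M := Γ(X, U)) b⟩

/-- The morphism from the structure sheaf given by a global section. -/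
def ofSec (s : Γ(M, ⊤)) : structureModule X ⟶ M :=
  (SheafOfModules.unitHomEquiv M).symm
    (PresheafOfModules.sectionsMk (fun V => res M (le_top : V.unop ≤ ⊤) s)
      (fun _ _ f => res_res M le_top (leOfHom f.unop) s))

lemma ofSec_oneSec (s : Γ(M, ⊤)) : (ofSec s).app ⊤ (oneSec X ⊤) = s := by
  have := SheafOfModules.unitHomEquiv_apply_coe M (ofSec s) (.op ⊤)
  rw [ofSec, Equiv.apply_symm_apply] at this
  exact this.symm.trans (res_self M le_rfl s)

variable (X) in
/-- The standard basis of a free module. -/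
def freeSec {J : Type u} (i : J) : Γ(free X J, ⊤) := (freeι X i).app ⊤ (oneSec X ⊤)

/-- For finite `J` the coproduct is also a product: the coordinate maps `π i` satisfy `∑ π i ≫ freeι
i = 𝟙`, and reading them on sections over any open gives independence and spanning. -/
lemma isFrame_freeSec {J : Type u} [Fintype J] : IsFrame (freeSec X (J := J)) := by
  classical
  let π (i : J) : free X J ⟶ structureModule X := freeDesc fun j => if j = i then 𝟙 _ else 0
  have h1 : ∑ i, π i ≫ freeι X i = 𝟙 _ := by
    apply free_hom_ext
    intro j
    simp [Preadditive.comp_sum, π, ite_comp]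
  have h2 (i j : J) (V : X.Opens) : (π i).app V (res _ le_top (freeSec X j)) =
      if j = i then oneSec X V else 0 := by
    have : (π i).app V (res _ le_top (freeSec X j)) = (freeι X j ≫ π i).app V (oneSec X V) := by
      rw [← res_oneSec le_top, app_res, app_res]
      rfl
    rw [this]
    simp only [π, freeι_desc]
    split_ifs <;> rfl
  refine isFrame_of (fun V hV a ha => ?_) (fun V hV b => ?_)
  · ext i
    have := congr((π i).app V $ha)
    simp only [map_sum, Hom.app_smul, h2, map_zero, smul_ite, smul_zero, Finset.sum_ite_eq',
      Finset.mem_univ, if_true] at this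
    exact congr($(smul_oneSec_injective (this.trans (zero_smul Γ(X, V) _).symm)))
  · choose a ha using fun i => exists_smul_oneSec ((π i).app V b)
    refine ⟨a, ?_⟩
    have h3 : (∑ i, π i ≫ freeι X i).app V b = b := by rw [h1]; rfl
    have h4 : (∑ i, π i ≫ freeι X i).app V b = ∑ i, (freeι X i).app V ((π i).app V b) := by
      let F : (free X J ⟶ free X J) →+ Γ(free X J, V) :=
        { toFun := fun φ => φ.app V b, map_zero' := rfl, map_add' := fun _ _ => rfl }
      exact map_sum F _ _
    rw [← h3, h4]
    refine Finset.sum_congr rfl fun i _ => ?_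
    rw [← ha i, Hom.app_smul, ← res_oneSec le_top, app_res]
    rfl

/-- The morphism from a free module given by global sections. -/
def freeHom {J : Type u} (s : J → Γ(M, ⊤)) : free X J ⟶ M := freeDesc fun i => ofSec (s i)

lemma freeHom_freeSec {J : Type u} (s : J → Γ(M, ⊤)) (i : J) :
    (freeHom s).app ⊤ (freeSec X i) = s i := by
  have : (freeHom s).app ⊤ (freeSec X i) = (freeι X i ≫ freeHom s).app ⊤ (oneSec X ⊤) := rfl
  rw [this, freeHom, freeι_desc, ofSec_oneSec]

lemma IsFrame.isIso_freeHom {J : Type u} [Fintype J] {s : J → Γ(M, ⊤)} (hs : IsFrame s) :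
    IsIso (freeHom s) := by
  apply isIso_of_bijective_app
  intro V
  rw [← isFrame_freeSec.bijective_comp (freeHom s) le_top]
  simp only [freeHom_freeSec]
  exact hs V le_top

/-- The pullback of a free module is free: `α` sends basis to pulled back basis, and its inverse `β`
is adjoint to the map from `free X J` to the pushforward of `free Y J` given by the basis. -/
lemma psec_freeSec_isFrame (f : Y ⟶ X) {J : Type u} [Fintype J] :
    IsFrame (fun i => psec f (le_refl (f ⁻¹ᵁ ⊤)) (freeSec X (J := J) i)) := by
  let α : free Y J ⟶ (Scheme.Modules.pullback f).obj (free X J) :=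
    freeHom (fun i => psec f (le_refl (f ⁻¹ᵁ ⊤)) (freeSec X (J := J) i))
  let β' : free X J ⟶ (pushforward f).obj (free Y J) :=
    freeHom (M := (pushforward f).obj (free Y J)) (fun i => freeSec Y i)
  let β : (Scheme.Modules.pullback f).obj (free X J) ⟶ free Y J :=
    ((pullbackPushforwardAdjunction f).homEquiv _ _).symm β'
  have hβ (U : X.Opens) (s : Γ(free X J, U)) :
      β.app (f ⁻¹ᵁ U) (psec f le_rfl s) = β'.app U s := by
    rw [psec_le_rfl]
    have := ((pullbackPushforwardAdjunction f).homEquiv _ _).apply_symm_apply β'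
    rw [Adjunction.homEquiv_unit] at this
    exact congr(($this).app U s)
  have hβ' (i : J) : β.app ⊤ (psec f (le_refl (f ⁻¹ᵁ ⊤)) (freeSec X i)) = freeSec Y i :=
    (hβ ⊤ (freeSec X i)).trans (freeHom_freeSec _ i)
  have h1 : α ≫ β = 𝟙 _ := by
    apply isFrame_freeSec.hom_ext
    intro i
    exact (congr(β.app ⊤ $(freeHom_freeSec _ i))).trans (hβ' i)
  have h2 : β ≫ α = 𝟙 _ := by
    apply ((pullbackPushforwardAdjunction f).homEquiv _ _).injective
    apply isFrame_freeSec.hom_ext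
    intro i
    rw [Adjunction.homEquiv_unit, Adjunction.homEquiv_unit]
    change (β ≫ α).app ⊤ (unitSec f _ ⊤ (freeSec X i)) = unitSec f _ ⊤ (freeSec X i)
    rw [← psec_le_rfl f le_rfl]
    exact (congr(α.app ⊤ $(hβ' i))).trans (freeHom_freeSec _ i)
  have : IsIso α := ⟨β, h1, h2⟩
  have h3 := isFrame_freeSec.map α
  have h4 : (fun i => α.app ⊤ (freeSec Y i)) =
      fun i => psec f (le_refl (f ⁻¹ᵁ ⊤)) (freeSec X i) := funext fun i => freeHom_freeSec _ i
  rwa [h4] at h3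

lemma IsFrame.psec_top {J : Type u} [Fintype J] {s : J → Γ(M, ⊤)} (hs : IsFrame s) (f : Y ⟶ X) :
    IsFrame (fun i => psec f (le_refl (f ⁻¹ᵁ ⊤)) (s i)) := by
  have := hs.isIso_freeHom
  have h := (psec_freeSec_isFrame f (J := J)).map ((Scheme.Modules.pullback f).map (freeHom s))
  have h3 (i : J) := app_psec f (freeHom s) (le_refl (f ⁻¹ᵁ ⊤)) (freeSec X i)
  simp only [h3, freeHom_freeSec] at h
  exact h

section Restrict

variable (j : Y ⟶ X) [IsOpenImmersion j] {W : Y.Opens}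

/-- Sections of a restriction. -/
def resSec (h : W ≤ j ⁻¹ᵁ U) : Γ(M, U) →+ Γ((restrictFunctor j).obj M, W) :=
  res M ((j.image_mono h).trans (j.image_preimage_le U))

/-- Sections of the restriction over `W'` are sections of `M` over `j ''ᵁ W'`; only the scalars have
to be identified, through `j.appIso`. -/
lemma isFrame_restrict_iff (s : I → Γ(M, j ''ᵁ W)) :
    IsFrame (M := (restrictFunctor j).obj M) (U := W) s ↔ IsFrame s := by
  have key (W' : Y.Opens) (h : W' ≤ W) (h' : j ''ᵁ W' ≤ j ''ᵁ W) :
      Function.Bijective (fun a : I → Γ(Y, W') =>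
        ∑ i, a i • res ((restrictFunctor j).obj M) h (s i)) ↔
      Function.Bijective (fun a : I → Γ(X, j ''ᵁ W') => ∑ i, a i • res M h' (s i)) := by
    have hb : Function.Bijective (fun (a : I → Γ(Y, W')) (i : I) =>
        ((j.appIso W').inv (a i) : Γ(X, j ''ᵁ W'))) :=
      (Equiv.piCongrRight (fun _ : I => (j.appIso W').commRingCatIsoToRingEquiv.symm.toEquiv)).bijective
    rw [← Function.Bijective.of_comp_iff _ hb]
    rfl
  constructor
  · intro h V hV
    -- Every open contained in `j ''ᵁ W` is the image of its preimage, so testing images of opens of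
    -- `Y` is enough.
    have hV' : V = j ''ᵁ (j ⁻¹ᵁ V) := by
      rw [Scheme.Hom.image_preimage_eq_opensRange_inf, eq_comm, inf_eq_right]
      exact hV.trans (j.image_le_opensRange _)
    have hW : j ⁻¹ᵁ V ≤ W := (j.preimage_mono hV).trans (j.preimage_image_eq W).le
    have := (key _ hW (j.image_mono hW)).1 (h _ hW)
    generalize j ⁻¹ᵁ V = V' at *
    subst hV'
    exact this
  · intro h W' hW'
    exact (key W' hW' (j.image_mono hW')).2 (h _ _)

/-- Restriction and pullback along an open immersion are both left adjoint to pushforward, and the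
unique isomorphism between them respects the units. -/
lemma psec_eq_restrict (h : W ≤ j ⁻¹ᵁ U) (s : Γ(M, U)) :
    psec j h s = ((restrictFunctorIsoPullback j).hom.app M).app W (resSec j h s) := by
  have key := Adjunction.unit_leftAdjointUniq_hom_app (restrictAdjunction j)
    (pullbackPushforwardAdjunction j) M
  have h1 : unitSec j M U s = ((restrictFunctorIsoPullback j).hom.app M).app (j ⁻¹ᵁ U)
      (res M (j.image_preimage_le U) s) := congr(($key).app U s).symm
  have h2 := app_res ((restrictFunctorIsoPullback j).hom.app M) h
    (resSec j (le_refl (j ⁻¹ᵁ U)) s)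
  rw [psec_def, h1]
  refine h2.symm.trans ?_
  congr 1
  exact res_res M (j.image_preimage_le U) (j.image_mono h) s

lemma isFrame_psec_openImmersion_iff (s : I → Γ(M, U)) (h : W ≤ j ⁻¹ᵁ U)
    (h' : j ''ᵁ W ≤ U) :
    IsFrame (fun i => psec j h (s i)) ↔ IsFrame (fun i => res M h' (s i)) := by
  rw [← isFrame_restrict_iff j]
  constructor
  · intro hs
    have := hs.map ((restrictFunctorIsoPullback j).inv.app M)
    refine (congrArg (IsFrame (M := (restrictFunctor j).obj M) (U := W)) (funext fun i => ?_)).mp this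
    refine (congrArg (((restrictFunctorIsoPullback j).inv.app M).app W)
      (psec_eq_restrict j h (s i))).trans ?_
    exact congr(($((restrictFunctorIsoPullback j).hom_inv_id_app M)).app W
      (resSec j h (s i)))
  · intro hs
    have := IsFrame.map hs ((restrictFunctorIsoPullback j).hom.app M)
    exact (congrArg IsFrame (funext fun i => psec_eq_restrict j h (s i))).mpr this

end Restrict

lemma isFrame_psec_comp_iff (f : Y ⟶ X) (g : X ⟶ Z) {M : Z.Modules} {U : Z.Opens} {V : X.Opens}
    {W : Y.Opens} (h : V ≤ g ⁻¹ᵁ U) (h' : W ≤ f ⁻¹ᵁ V) (s : I → Γ(M, U)) :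
    IsFrame (fun i => psec f h' (psec g h (s i))) ↔
      IsFrame (fun i => psec (f ≫ g) (h'.trans (f.preimage_mono h)) (s i)) := by
  constructor
  · intro hs
    have := hs.map ((pullbackComp f g).hom.app M)
    exact (congrArg IsFrame (funext fun i => pullbackComp_psec f g h h' (s i))).mp this
  · intro hs
    have := hs.map ((pullbackComp f g).inv.app M)
    exact (congrArg IsFrame (funext fun i => pullbackComp_inv_psec f g h h' (s i))).mp this

/-- The pullback of a frame is a frame. -/
lemma IsFrame.psec {J : Type u} [Fintype J] {s : J → Γ(M, U)} (hs : IsFrame s) (f : Y ⟶ X)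
    {V : Y.Opens} (h : V ≤ f ⁻¹ᵁ U) : IsFrame (fun i => TorusPerf.psec f h (s i)) := by
  -- The case of global sections is applied to the restriction `f⁻¹ U ⟶ U` of `f`; the two open
  -- immersions are then removed by commuting the square `hc`.
  let j := U.ι
  let j' := (f ⁻¹ᵁ U).ι
  let g := f ∣_ U
  have hc : g ≫ j = j' ≫ f := morphismRestrict_ι f U
  have h1 : IsFrame (fun i => TorusPerf.psec j (show ⊤ ≤ j ⁻¹ᵁ U by simp [j]) (s i)) := by
    rw [isFrame_psec_openImmersion_iff j s _ (by simp [j])]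
    exact hs.res _
  have h2 := h1.psec_top g
  rw [isFrame_psec_comp_iff] at h2
  have h3 : IsFrame (fun i => TorusPerf.psec (j' ≫ f)
      (show ⊤ ≤ (j' ≫ f) ⁻¹ᵁ U by simp [j']) (s i)) := by
    generalize_proofs at h2 ⊢
    revert h2
    generalize g ≫ j = k at *
    subst hc
    exact id
  have h4 : IsFrame (fun i => TorusPerf.psec j' (show ⊤ ≤ j' ⁻¹ᵁ f ⁻¹ᵁ U by simp [j'])
      (TorusPerf.psec f le_rfl (s i))) := (isFrame_psec_comp_iff j' f _ _ s).2 h3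
  rw [isFrame_psec_openImmersion_iff j' _ _ (by simp [j'])] at h4
  simpa [res_psec] using h4.res (show V ≤ j' ''ᵁ ⊤ by simpa [j'] using h)

/-- `M` is finite locally free if and only if it has a frame around every point. -/
lemma isFiniteLocallyFree_iff : IsFiniteLocallyFree M ↔ ∀ x : X, ∃ (U : X.Opens) (_ : x ∈ U)
    (n : ℕ) (s : ULift.{u} (Fin n) → Γ(M, U)), IsFrame s := by
  constructor
  · intro h x
    obtain ⟨U, hx, n, ⟨e⟩⟩ := h x
    have h1 := (isFrame_freeSec (X := U.toScheme) (J := ULift.{u} (Fin n))).map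
      (show free U.toScheme (ULift.{u} (Fin n)) ≅ (restrictFunctor U.ι).obj M from e.symm).hom
    exact ⟨U.ι ''ᵁ ⊤, by simpa using hx, n, _, (isFrame_restrict_iff U.ι _).1 h1⟩
  · intro h x
    obtain ⟨U, hx, n, s, hs⟩ := h x
    have h1 : IsFrame (M := (restrictFunctor U.ι).obj M) (U := ⊤)
      (fun i => res M (show U.ι ''ᵁ ⊤ ≤ U by simp) (s i)) :=
      (isFrame_restrict_iff U.ι _).2 (hs.res _)
    have := h1.isIso_freeHom
    exact ⟨U, hx, n, ⟨(@asIso _ _ _ _ _ this).symm⟩⟩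

end Frames
end TorusPerf
end

/-! ### Locality of sections, characters, and functions on a torus over a base. -/

noncomputable section

namespace TorusPerf

open Scheme.Modules

lemma res_eq_of_locally_eq {X : Scheme.{u}} {M : X.Modules} {U : X.Opens} (s t : Γ(M, U))
    (h : ∀ x ∈ U, ∃ (V : X.Opens) (hV : V ≤ U), x ∈ V ∧ res M hV s = res M hV t) : s = t := by
  choose V hV hx hst using fun x : U => h x.1 x.2
  exact TopCat.Sheaf.eq_of_locally_eq' (⟨M.presheaf, M.isSheaf⟩ : TopCat.Sheaf Ab X) V U
    (fun x => homOfLE (hV x)) (fun x hxU => TopologicalSpace.Opens.mem_iSup.2 ⟨⟨x, hxU⟩, hx _⟩)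
    s t hst

lemma resO_eq_of_locally_eq {X : Scheme.{u}} {U : X.Opens} (s t : Γ(X, U))
    (h : ∀ x ∈ U, ∃ (V : X.Opens) (hV : V ≤ U), x ∈ V ∧ resO hV s = resO hV t) : s = t :=
  res_eq_of_locally_eq (M := structureModule X) s t h

lemma exists_affine_le {X : Scheme.{u}} {U : X.Opens} {x : X} (hx : x ∈ U) :
    ∃ V : X.Opens, IsAffineOpen V ∧ x ∈ V ∧ V ≤ U := by
  obtain ⟨V, hV, hxV, hVU⟩ :=
    (TopologicalSpace.Opens.isBasis_iff_nbhd.1 X.isBasis_affineOpens) hx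
  exact ⟨V, hV, hxV, hVU⟩

lemma pbO_congr {X Y : Scheme.{u}} {f g : Y ⟶ X} (hfg : f = g) {U : X.Opens} {V : Y.Opens}
    (h : V ≤ f ⁻¹ᵁ U) (a : Γ(X, U)) : pbO f h a = pbO g (hfg ▸ h) a := by
  subst hfg
  rfl

section Characters

variable {S : Scheme.{u}} {T : Over S} [GrpObj T] {t : ℕ} (e : TorusSplitting T t)
variable {X Y Z : Over S}

/-- The value of the character of weight `l` at a point of the torus. -/
def chi (τ : Y ⟶ T) (l : Fin t → ℤ) : Γ(Y.left, ⊤)ˣ := ∏ i, e.coord Y τ i ^ l i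

/-- The restriction to an open of the value of a character. -/
def chiOn (τ : Y ⟶ T) (l : Fin t → ℤ) (V : Y.left.Opens) : Γ(Y.left, V) :=
  resO le_top (chi e τ l).val

lemma resO_chiOn (τ : Y ⟶ T) (l : Fin t → ℤ) {V W : Y.left.Opens} (h : W ≤ V) :
    resO h (chiOn e τ l V) = chiOn e τ l W := by
  simp [chiOn]

lemma chi_comp (g : Z ⟶ Y) (τ : Y ⟶ T) (l : Fin t → ℤ) :
    chi e (g ≫ τ) l = Units.map g.left.appTop.hom.toMonoidHom (chi e τ l) := by
  simp only [chi, map_prod, map_zpow, e.coord_comp]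

lemma pbO_chiOn (g : Z ⟶ Y) (τ : Y ⟶ T) (l : Fin t → ℤ) {V : Y.left.Opens} {W : Z.left.Opens}
    (h : W ≤ g.left ⁻¹ᵁ V) : pbO g.left h (chiOn e τ l V) = chiOn e (g ≫ τ) l W := by
  simp only [chiOn, chi_comp, pbO_resO]
  rfl

lemma chi_add (τ : Y ⟶ T) (l m : Fin t → ℤ) : chi e τ (l + m) = chi e τ l * chi e τ m := by
  simp only [chi, Pi.add_apply, zpow_add, Finset.prod_mul_distrib]

lemma chi_zero (τ : Y ⟶ T) : chi e τ 0 = 1 := by simp [chi]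

lemma chi_mul (τ σ : Y ⟶ T) (l : Fin t → ℤ) : chi e (τ * σ) l = chi e τ l * chi e σ l := by
  simp only [chi, map_mul, Pi.mul_apply, mul_zpow, Finset.prod_mul_distrib]

lemma chi_single (τ : Y ⟶ T) (i : Fin t) : chi e τ (Pi.single i 1) = e.coord Y τ i := by
  classical
  rw [chi, Finset.prod_eq_single i] <;> simp +contextual

lemma chiOn_add (τ : Y ⟶ T) (l m : Fin t → ℤ) (V : Y.left.Opens) :
    chiOn e τ (l + m) V = chiOn e τ l V * chiOn e τ m V := by
  simp [chiOn, chi_add]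

lemma chiOn_zero (τ : Y ⟶ T) (V : Y.left.Opens) : chiOn e τ 0 V = 1 := by
  simp [chiOn, chi_zero]

lemma chiOn_mul (τ σ : Y ⟶ T) (l : Fin t → ℤ) (V : Y.left.Opens) :
    chiOn e (τ * σ) l V = chiOn e τ l V * chiOn e σ l V := by
  simp [chiOn, chi_mul]

/-- The homomorphism from the group algebra of the character group over `Γ(X, U)` to the functions
on `f⁻¹ U`. -/
def groupAlgebraHom (τ : Y ⟶ T) (f : Y ⟶ X) (U : X.left.Opens) :
    AddMonoidAlgebra Γ(X.left, U) (Fin t → ℤ) →+* Γ(Y.left, f.left ⁻¹ᵁ U) :=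
  AddMonoidAlgebra.liftNCRingHom (pbO f.left le_rfl)
    { toFun := fun l => chiOn e τ l.toAdd _
      map_one' := chiOn_zero e τ _
      map_mul' := fun l m => chiOn_add e τ l.toAdd m.toAdd _ } (fun _ _ => mul_comm _ _)

lemma groupAlgebraHom_single (τ : Y ⟶ T) (f : Y ⟶ X) (U : X.left.Opens) (l : Fin t → ℤ)
    (a : Γ(X.left, U)) : groupAlgebraHom e τ f U (AddMonoidAlgebra.single l a) =
      pbO f.left le_rfl a * chiOn e τ l _ :=
  AddMonoidAlgebra.liftNCRingHom_single ..

section Affine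

variable {U : X.left.Opens} (hU : IsAffineOpen U)

variable (t U) in
/-- The group algebra of the character group over `Γ(X, U)`. -/
abbrev groupAlgebra : CommRingCat.{u} :=
  CommRingCat.of (AddMonoidAlgebra Γ(X.left, U) (Fin t → ℤ))

variable (t) in
/-- The projection from the torus over `U` to `X`. -/
def torusProj : Spec (groupAlgebra t U) ⟶ X.left :=
  Spec.map (CommRingCat.ofHom (algebraMap Γ(X.left, U) (AddMonoidAlgebra Γ(X.left, U) (Fin t → ℤ)))) ≫
    hU.fromSpec

variable (t) in
/-- The torus over `U`, as a scheme over `S`. -/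
abbrev torusOver : Over S := Over.mk (torusProj t hU ≫ X.hom)

variable (t) in
/-- The projection from the torus over `U` to `X`, as a morphism over `S`. -/
def torusProjOver : torusOver t hU ⟶ X := Over.homMk (torusProj t hU)

variable (t U) in
/-- The universal characters. -/
def monomialUnits (l : Fin t → ℤ) : (groupAlgebra t U)ˣ where
  val := AddMonoidAlgebra.single l 1
  inv := AddMonoidAlgebra.single (-l) 1
  val_inv := by
    rw [AddMonoidAlgebra.single_mul_single]
    simp [← AddMonoidAlgebra.one_def]
  inv_val := by
    rw [AddMonoidAlgebra.single_mul_single]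
    simp [← AddMonoidAlgebra.one_def]

/-- The universal point of the torus. -/
def universalPoint : torusOver t hU ⟶ T :=
  (e.coord _).symm fun i => Units.map (Scheme.ΓSpecIso (groupAlgebra t U)).inv.hom.toMonoidHom
    (monomialUnits t U (Pi.single i 1))

/-- Both sides are multiplicative in `l`, and the universal point is defined by the values on the
standard basis vectors. -/
lemma chi_universalPoint (l : Fin t → ℤ) : chi e (universalPoint e hU) l =
    Units.map (Scheme.ΓSpecIso (groupAlgebra t U)).inv.hom.toMonoidHom (monomialUnits t U l) := by
  let F : Multiplicative (Fin t → ℤ) →* (groupAlgebra t U)ˣ :=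
    { toFun := fun l => monomialUnits t U l.toAdd
      map_one' := Units.ext AddMonoidAlgebra.one_def.symm
      map_mul' := fun l m => Units.ext (by
        change _ = AddMonoidAlgebra.single l.toAdd 1 * AddMonoidAlgebra.single m.toAdd 1
        rw [AddMonoidAlgebra.single_mul_single]
        simp [monomialUnits]) }
  have h : monomialUnits t U l = ∏ i, monomialUnits t U (Pi.single i 1) ^ l i := by
    have : Multiplicative.ofAdd l = ∏ i, Multiplicative.ofAdd (Pi.single i 1 : Fin t → ℤ) ^ l i := by
      classical
      apply Multiplicative.toAdd.injective
      rw [toAdd_prod]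
      ext j
      simp [Finset.sum_apply, Pi.single_apply]
    calc monomialUnits t U l = F (Multiplicative.ofAdd l) := rfl
      _ = _ := by rw [this, map_prod]; simp only [map_zpow]; rfl
  rw [h, map_prod]
  simp only [chi, universalPoint, MulEquiv.apply_symm_apply, map_zpow]

variable (τ : Y ⟶ T) (f : Y ⟶ X)

/-- The morphism from the preimage of `U` to the torus over `U`. -/
def toTorus : (f.left ⁻¹ᵁ U).toScheme ⟶ Spec (groupAlgebra t U) :=
  (f.left ⁻¹ᵁ U).toSpecΓ ≫ Spec.map (CommRingCat.ofHom (groupAlgebraHom e τ f U))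

lemma toTorus_torusProj : toTorus e τ f ≫ torusProj t hU = (f.left ⁻¹ᵁ U).ι ≫ f.left := by
  have h : (CommRingCat.ofHom (algebraMap Γ(X.left, U) (AddMonoidAlgebra Γ(X.left, U) (Fin t → ℤ)))) ≫
      CommRingCat.ofHom (groupAlgebraHom e τ f U) = f.left.appLE U (f.left ⁻¹ᵁ U) le_rfl := by
    ext a
    change groupAlgebraHom e τ f U (AddMonoidAlgebra.single 0 a) = _
    rw [groupAlgebraHom_single, chiOn_zero, _root_.mul_one]
    rfl
  rw [toTorus, torusProj, Category.assoc, ← Spec.map_comp_assoc, h, 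
    Scheme.Opens.toSpecΓ_SpecMap_appLE_assoc, hU.toSpecΓ_fromSpec]
  simp

/-- The preimage of `U`, as a scheme over `S`. -/
abbrev preimageOver (f : Y ⟶ X) (U : X.left.Opens) : Over S :=
  Over.mk ((f.left ⁻¹ᵁ U).ι ≫ Y.hom)

/-- The inclusion of the preimage of `U`, as a morphism over `S`. -/
def preimageOverι (f : Y ⟶ X) (U : X.left.Opens) : preimageOver f U ⟶ Y :=
  Over.homMk (f.left ⁻¹ᵁ U).ι

/-- The morphism from the preimage of `U` to the torus over `U`, as a morphism over `S`. -/
def toTorusOver : preimageOver f U ⟶ torusOver t hU := Over.homMk (toTorus e τ f) (by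
  simp [reassoc_of% toTorus_torusProj e hU τ f])

lemma toTorus_appTop (r : groupAlgebra t U) :
    (toTorus e τ f).appTop ((Scheme.ΓSpecIso (groupAlgebra t U)).inv r) =
      (f.left ⁻¹ᵁ U).topIso.inv (groupAlgebraHom e τ f U r) := by
  have h : (Scheme.ΓSpecIso (groupAlgebra t U)).inv ≫ (toTorus e τ f).appTop =
      CommRingCat.ofHom (groupAlgebraHom e τ f U) ≫ (f.left ⁻¹ᵁ U).topIso.inv := by
    rw [toTorus, Scheme.Hom.comp_appTop, Scheme.Opens.toSpecΓ_appTop,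
      ← Scheme.ΓSpecIso_inv_naturality_assoc, Iso.inv_hom_id_assoc]
  exact congr($h r)

lemma pbO_ι {W : Y.left.Opens} (h : ⊤ ≤ W.ι ⁻¹ᵁ W) (x : Γ(Y.left, W)) :
    pbO W.ι h x = W.topIso.inv x := by
  have : W.ι.appLE W ⊤ h = W.topIso.inv := by
    rw [Scheme.Opens.ι_appLE]
    rfl
  exact congr($this x)

lemma appTop_eq_pbO {X Y : Scheme.{u}} (f : Y ⟶ X) (x : Γ(X, ⊤))
    (h : ⊤ ≤ f ⁻¹ᵁ ⊤) : f.appTop x = pbO f h x := (resO_self _ _).symm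

lemma preimage_ι_appTop (x : Γ(Y.left, ⊤)) :
    (f.left ⁻¹ᵁ U).ι.appTop x = (f.left ⁻¹ᵁ U).topIso.inv (resO le_top x) := by
  rw [← pbO_ι (by simp), pbO_resO, appTop_eq_pbO]

/-- A morphism to `T` is determined by its coordinates, and `groupAlgebraHom` sends the monomials of
the universal point to the coordinates of `τ`. -/
lemma toTorusOver_universalPoint :
    toTorusOver e hU τ f ≫ universalPoint e hU = preimageOverι f U ≫ τ := by
  apply (e.coord _).injective
  ext i
  rw [e.coord_comp, e.coord_comp, universalPoint, MulEquiv.apply_symm_apply]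
  change (toTorus e τ f).appTop ((Scheme.ΓSpecIso (groupAlgebra t U)).inv
    (AddMonoidAlgebra.single (Pi.single i 1) 1)) = (f.left ⁻¹ᵁ U).ι.appTop (e.coord Y τ i).val
  rw [toTorus_appTop, preimage_ι_appTop, groupAlgebraHom_single, map_one, _root_.one_mul, ← chi_single]
  rfl

variable [IsIso (lift τ f)]

/-- The morphism from the torus over `U`. -/
def ofTorusOver : torusOver t hU ⟶ Y :=
  lift (universalPoint e hU) (torusProjOver t hU) ≫ inv (lift τ f)

lemma ofTorusOver_fst : ofTorusOver e hU τ f ≫ τ = universalPoint e hU := by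
  have : inv (lift τ f) ≫ τ = fst _ _ := by simp [IsIso.inv_comp_eq]
  simp [ofTorusOver, this]

lemma ofTorusOver_snd : ofTorusOver e hU τ f ≫ f = torusProjOver t hU := by
  have : inv (lift τ f) ≫ f = snd _ _ := by simp [IsIso.inv_comp_eq]
  simp [ofTorusOver, this]

/-- As `lift τ f` identifies `Y` with `T ⊗ X`, the equality may be tested on the two components,
where the universal properties of both maps apply. -/
lemma toTorusOver_ofTorusOver : toTorusOver e hU τ f ≫ ofTorusOver e hU τ f = preimageOverι f U := by
  rw [← cancel_mono (lift τ f)]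
  apply CartesianMonoidalCategory.hom_ext
  · simp [ofTorusOver_fst, toTorusOver_universalPoint]
  · simp only [Category.assoc, lift_snd, ofTorusOver_snd]
    ext1
    exact toTorus_torusProj e hU τ f

lemma torusProj_preimage : torusProj t hU ⁻¹ᵁ U = ⊤ := by
  rw [torusProj, Scheme.Hom.comp_preimage, hU.fromSpec_preimage_self]
  rfl

lemma ofTorusOver_preimage : ⊤ ≤ (ofTorusOver e hU τ f).left ⁻¹ᵁ f.left ⁻¹ᵁ U := by
  have : (ofTorusOver e hU τ f ≫ f).left = torusProj t hU := by rw [ofTorusOver_snd]; rfl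
  rw [Over.comp_left] at this
  rw [← Scheme.Hom.comp_preimage, this, torusProj_preimage]

lemma pbO_fromSpec {X : Scheme.{u}} {U : X.Opens} (hU : IsAffineOpen U)
    (h : ⊤ ≤ hU.fromSpec ⁻¹ᵁ U) (a : Γ(X, U)) :
    pbO hU.fromSpec h a = (Scheme.ΓSpecIso Γ(X, U)).inv a := by
  have : hU.fromSpec.appLE U ⊤ h = (Scheme.ΓSpecIso Γ(X, U)).inv := by
    rw [Scheme.Hom.appLE, hU.fromSpec_app_self, Category.assoc, ← Functor.map_comp]
    exact (congrArg _ (CategoryTheory.Functor.map_id _ _)).trans (Category.comp_id _)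
  exact congr($this a)

lemma pbO_torusProj (h : ⊤ ≤ torusProj t hU ⁻¹ᵁ U) (a : Γ(X.left, U)) :
    pbO (torusProj t hU) h a =
      (Scheme.ΓSpecIso (groupAlgebra t U)).inv (AddMonoidAlgebra.single 0 a) := by
  let φ := CommRingCat.ofHom
    (algebraMap Γ(X.left, U) (AddMonoidAlgebra Γ(X.left, U) (Fin t → ℤ)))
  have h1 := pbO_pbO (Spec.map φ) hU.fromSpec hU.fromSpec_preimage_self.ge (W := ⊤) le_top a
  refine h1.symm.trans ?_
  rw [pbO_fromSpec]
  exact (appTop_eq_pbO _ _ le_top).symm.trans congr($((Scheme.ΓSpecIso_inv_naturality φ).symm) a)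

lemma pbO_ofTorusOver (r : groupAlgebra t U) :
    pbO (ofTorusOver e hU τ f).left (ofTorusOver_preimage e hU τ f) (groupAlgebraHom e τ f U r) =
      (Scheme.ΓSpecIso (groupAlgebra t U)).inv r := by
  have h : (pbO (ofTorusOver e hU τ f).left (ofTorusOver_preimage e hU τ f)).comp
      (groupAlgebraHom e τ f U) = (Scheme.ΓSpecIso (groupAlgebra t U)).inv.hom := by
    -- A ring homomorphism out of the group algebra is fixed by its values on coefficients and on
    -- monomials.
    apply AddMonoidAlgebra.ringHom_ext
    · intro a
      rw [RingHom.comp_apply, groupAlgebraHom_single, chiOn_zero, _root_.mul_one, pbO_pbO]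
      have h := congrArg Over.Hom.left (ofTorusOver_snd e hU τ f)
      rw [Over.comp_left] at h
      exact (pbO_congr h _ a).trans (pbO_torusProj hU (torusProj_preimage hU).ge a)
    · intro l
      rw [RingHom.comp_apply, groupAlgebraHom_single, map_one, _root_.one_mul, pbO_chiOn,
        ofTorusOver_fst, chiOn, chi_universalPoint, resO_self]
      rfl
  exact congr($h r)

/-- Functions on the preimage of an affine open are Laurent polynomials. -/
lemma groupAlgebraHom_bijective {U : X.left.Opens} (hU : IsAffineOpen U) :
    Function.Bijective (groupAlgebraHom e τ f U) := by
  have hinj := (ConcreteCategory.bijective_of_isIso (Scheme.ΓSpecIso (groupAlgebra t U)).inv)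
  have hinj' := (ConcreteCategory.bijective_of_isIso (f.left ⁻¹ᵁ U).topIso.inv).1
  constructor
  -- Pulling back along `ofTorusOver` is a left inverse, hence injectivity. For surjectivity, a
  -- preimage of `x` is its own pullback to the torus: returning along `toTorus` restricts `x` to
  -- the preimage of `U`, which loses nothing.
  · intro r r' h
    apply hinj.1
    rw [← pbO_ofTorusOver e hU τ f, ← pbO_ofTorusOver e hU τ f, h]
  · intro x
    obtain ⟨r, hr⟩ := hinj.2 (pbO (ofTorusOver e hU τ f).left (ofTorusOver_preimage e hU τ f) x)
    refine ⟨r, hinj' ?_⟩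
    have h := congrArg Over.Hom.left (toTorusOver_ofTorusOver e hU τ f)
    rw [Over.comp_left] at h
    rw [← toTorus_appTop, hr]
    exact (appTop_eq_pbO _ _ le_top).trans ((pbO_pbO _ _ (ofTorusOver_preimage e hU τ f) _ x).trans
      ((pbO_congr h _ x).trans (pbO_ι _ x)))

end Affine

section

variable (τ : Y ⟶ T) (f : Y ⟶ X) [IsIso (lift τ f)]

lemma exists_eq_sum_chiOn {U : X.left.Opens} (hU : IsAffineOpen U)
    (b : Γ(Y.left, f.left ⁻¹ᵁ U)) : ∃ (a : (Fin t → ℤ) →₀ Γ(X.left, U)),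
      b = a.sum fun l c => pbO f.left le_rfl c * chiOn e τ l _ := by
  obtain ⟨r, rfl⟩ := (groupAlgebraHom_bijective e τ f hU).2 b
  exact ⟨r.coeff, rfl⟩

/-- Linear independence of characters over an arbitrary open: vanishing of the coefficients is
local, and over affine opens it is injectivity of `groupAlgebraHom`. Spanning, in contrast, is only
available over affine opens, since infinitely many characters could occur otherwise. -/
lemma eq_zero_of_sum_chiOn {U : X.left.Opens} {V : Y.left.Opens} (hV : V = f.left ⁻¹ᵁ U)
    (a : (Fin t → ℤ) →₀ Γ(X.left, U))
    (ha : (a.sum fun l c => pbO f.left hV.le c * chiOn e τ l V) = 0) : a = 0 := by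
  subst hV
  ext l
  refine resO_eq_of_locally_eq _ _ fun x hx => ?_
  obtain ⟨W, hW, hxW, hWU⟩ := exists_affine_le hx
  refine ⟨W, hWU, hxW, ?_⟩
  have : groupAlgebraHom e τ f W (.ofCoeff (a.mapRange (resO hWU) (map_zero _))) = 0 := by
    have := congr(resO (f.left.preimage_mono hWU) $ha)
    rw [map_zero] at this
    rw [← this]
    simp only [Finsupp.sum, map_sum, map_mul, resO_pbO, resO_chiOn]
    change ((a.mapRange (resO hWU) (map_zero _)).sum fun l c => pbO f.left le_rfl c * chiOn e τ l _) = _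
    rw [Finsupp.sum_mapRange_index (by simp)]
    simp only [Finsupp.sum, pbO_resO]
  have h0 := (groupAlgebraHom_bijective e τ f hW).1 (this.trans (map_zero _).symm)
  have := congr(($h0).coeff l)
  simpa using this

end

end Characters
end TorusPerf
end

/-! ### Scalars, homogeneous sections and structures of pure weight. -/

noncomputable section

namespace TorusPerf

open Scheme.Modules

section Scalars

variable {X : Scheme.{u}}

/-- Multiplication by a global function. -/
def smulHom (r : Γ(X, ⊤)) (M : X.Modules) : M ⟶ M :=
  ⟨PresheafOfModules.homMk
    { app := fun U => AddCommGrpCat.ofHom (DistribSMul.toAddMonoidHom Γ(M, U.unop)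
        (resO (le_top : U.unop ≤ ⊤) r))
      naturality := by
        intro U V f
        ext s
        have := res_smul M (leOfHom f.unop) (resO (le_top : U.unop ≤ ⊤) r) s
        rw [resO_resO] at this
        exact this.symm }
    (fun U a s => smul_comm (M := Γ(X, U.unop)) (N := Γ(X, U.unop)) (α := Γ(M, U.unop))
      (resO (le_top : U.unop ≤ ⊤) r) a s)⟩

lemma smulHom_app (r : Γ(X, ⊤)) (M : X.Modules) {U : X.Opens} (s : Γ(M, U)) :
    (smulHom r M).app U s = (resO le_top r : Γ(X, U)) • s := rfl

lemma smulHom_smulHom (r r' : Γ(X, ⊤)) (M : X.Modules) (h : r * r' = 1) :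
    smulHom r M ≫ smulHom r' M = 𝟙 M := by
  ext U s
  change (resO le_top r' : Γ(X, U)) • (resO le_top r : Γ(X, U)) • s = s
  rw [smul_smul, ← map_mul, mul_comm, h, map_one, one_smul]

lemma comp_smulHom_app {M N : X.Modules} (φ : M ⟶ N) (r : Γ(X, ⊤)) {U : X.Opens} (s : Γ(M, U)) :
    (φ ≫ smulHom r N).app U s = (resO le_top r : Γ(X, U)) • φ.app U s := by
  rw [Hom.comp_app, AddCommGrpCat.comp_apply, smulHom_app]

/-- Turns the sectionwise condition in `IsConcentrated` into an equality of morphisms. The proofs of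
`f = g`, the scalar and the inclusions are free parameters so that the left side matches that
definition. -/
lemma eq_congr_comp_smulHom_iff {Y : Scheme.{u}} {f g : Y ⟶ X} (hfg hfg' : f = g)
    (M : X.Modules) (r r' : Γ(Y, ⊤)) (hr : r' = r) (hle : ∀ U : Y.Opens, U ≤ ⊤)
    (φ ψ : (Scheme.Modules.pullback f).obj M ⟶ (Scheme.Modules.pullback g).obj M)
    (hψ : ψ = (pullbackCongr hfg').hom.app M ≫ smulHom r' _) :
    (∀ (U : Y.Opens) (s : Γ((Scheme.Modules.pullback f).obj M, U)),
      φ.app U s = Y.presheaf.map (homOfLE (hle U)).op r •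
        ((pullbackCongr hfg).hom.app M).app U s) ↔ φ = ψ := by
  obtain rfl : hfg = hfg' := rfl
  subst hr hψ
  have key (U : Y.Opens) (s : Γ((Scheme.Modules.pullback f).obj M, U)) :
      ((pullbackCongr hfg).hom.app M ≫ smulHom r' _).app U s =
        Y.presheaf.map (homOfLE (hle U)).op r' • ((pullbackCongr hfg).hom.app M).app U s := by
    have h : (resO le_top r' : Γ(Y, U)) = Y.presheaf.map (homOfLE (hle U)).op r' := rfl
    rw [comp_smulHom_app, h]
  constructor
  · intro h
    ext U s
    exact (h U s).trans (key U s).symm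
  · rintro rfl U s
    exact key U s

end Scalars

section Homogeneous

variable {S : Scheme.{u}} {T : Over S} [GrpObj T] {t : ℕ} (e : TorusSplitting T t)
variable {X : Over S} [ModObj T X]

lemma actLeft_eq (hX : IsTrivialAction T X) : actLeft T X = projLeft T X := congrArg Over.Hom.left hX

lemma actLeft_preimage (hX : IsTrivialAction T X) (U : X.left.Opens) : actLeft T X ⁻¹ᵁ U = projLeft T X ⁻¹ᵁ U := by
  rw [actLeft_eq hX]

variable (hX : IsTrivialAction T X)

/-- A section of an equivariant module on which the torus acts through a character. -/
def IsHomogeneous (M : EquivariantModule T X) (l : Fin t → ℤ) {U : X.left.Opens}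
    (s : Γ(M.obj, U)) : Prop :=
  M.φ.hom.app (projLeft T X ⁻¹ᵁ U) (psec (actLeft T X) (actLeft_preimage hX U).ge s) =
    chiOn e (fst T X) l (projLeft T X ⁻¹ᵁ U) • psec (projLeft T X) le_rfl s

variable {e hX} {M N : EquivariantModule T X} {l : Fin t → ℤ} {U : X.left.Opens}

lemma IsHomogeneous.app_psec {s : Γ(M.obj, U)} (hs : IsHomogeneous e hX M l s)
    {V : (T ⊗ X).left.Opens} (h : V ≤ actLeft T X ⁻¹ᵁ U) (h' : V ≤ projLeft T X ⁻¹ᵁ U) :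
    M.φ.hom.app V (psec (actLeft T X) h s) = chiOn e (fst T X) l V • psec (projLeft T X) h' s := by
  have := congr(res _ h' $hs)
  rw [← app_res, res_psec, res_smul, res_psec, resO_chiOn] at this
  exact this

lemma IsHomogeneous.res {s : Γ(M.obj, U)} (hs : IsHomogeneous e hX M l s) {V : X.left.Opens}
    (h : V ≤ U) : IsHomogeneous e hX M l (TorusPerf.res M.obj h s) := by
  rw [IsHomogeneous, psec_res, psec_res]
  exact hs.app_psec _ _

lemma IsHomogeneous.add {s s' : Γ(M.obj, U)} (hs : IsHomogeneous e hX M l s)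
    (hs' : IsHomogeneous e hX M l s') : IsHomogeneous e hX M l (s + s') := by
  rw [IsHomogeneous] at *
  rw [map_add, map_add, map_add, hs, hs', smul_add]

lemma isHomogeneous_zero : IsHomogeneous e hX M l (0 : Γ(M.obj, U)) := by
  rw [IsHomogeneous, map_zero, map_zero, map_zero, smul_zero]

lemma pbO_actLeft (hX : IsTrivialAction T X) (h : projLeft T X ⁻¹ᵁ U ≤ actLeft T X ⁻¹ᵁ U) (a : Γ(X.left, U)) :
    pbO (actLeft T X) h a = pbO (projLeft T X) le_rfl a :=
  pbO_congr (actLeft_eq hX) h a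

lemma IsHomogeneous.smul {s : Γ(M.obj, U)} (hs : IsHomogeneous e hX M l s) (a : Γ(X.left, U)) :
    IsHomogeneous e hX M l (a • s) := by
  rw [IsHomogeneous] at *
  rw [psec_smul, Hom.app_smul, hs, psec_smul, pbO_actLeft hX, smul_comm]

lemma IsHomogeneous.map {s : Γ(M.obj, U)} (hs : IsHomogeneous e hX M l s) (f : M ⟶ N) :
    IsHomogeneous e hX N l (f.hom.app U s) := by
  rw [IsHomogeneous] at *
  have h1 := congr(($f.comm).app (projLeft T X ⁻¹ᵁ U)
    (psec (actLeft T X) (actLeft_preimage hX U).ge s))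
  rw [Hom.comp_app, Hom.comp_app, AddCommGrpCat.comp_apply, AddCommGrpCat.comp_apply, hs,
    TorusPerf.app_psec, Hom.app_smul, TorusPerf.app_psec] at h1
  exact h1

variable (e hX l) in
/-- The structure isomorphism of weight `l`. -/
def weightIso (M : X.left.Modules) : (actPull T X).obj M ≅ (projPull T X).obj M where
  hom := (pullbackCongr (actLeft_eq hX)).hom.app M ≫ smulHom (chi e (fst T X) l).val _
  inv := smulHom (chi e (fst T X) l).inv _ ≫ (pullbackCongr (actLeft_eq hX)).inv.app M
  hom_inv_id := by
    rw [Category.assoc, reassoc_of% smulHom_smulHom _ _ _ (chi e (fst T X) l).val_inv,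
      Iso.hom_inv_id_app]
  inv_hom_id := by
    rw [Category.assoc, Iso.inv_hom_id_app_assoc, smulHom_smulHom _ _ _ (chi e (fst T X) l).inv_val]

lemma weightIso_hom (M : X.left.Modules) : (weightIso e hX l M).hom =
    (pullbackCongr (actLeft_eq hX)).hom.app M ≫ smulHom (chi e (fst T X) l).val _ := rfl

lemma weightIso_hom_app (M : X.left.Modules) (s : Γ(M, U)) {V : (T ⊗ X).left.Opens}
    (h : V ≤ actLeft T X ⁻¹ᵁ U) (h' : V ≤ projLeft T X ⁻¹ᵁ U) :
    (weightIso e hX l M).hom.app V (psec (actLeft T X) h s) =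
      chiOn e (fst T X) l V • psec (projLeft T X) h' s := by
  rw [weightIso_hom, comp_smulHom_app, pullbackCongr_psec, chiOn]

lemma isConcentrated_iff_hom_eq :
    IsConcentrated e hX l M ↔ M.φ.hom = (weightIso e hX l M.obj).hom := by
  unfold IsConcentrated
  exact eq_congr_comp_smulHom_iff _ (actLeft_eq hX) M.obj _ (chi e (fst T X) l).val rfl _ M.φ.hom _
    (weightIso_hom M.obj)

lemma isConcentrated_iff : IsConcentrated e hX l M ↔
    ∀ (U : X.left.Opens) (s : Γ(M.obj, U)), IsHomogeneous e hX M l s := by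
  rw [isConcentrated_iff_hom_eq]
  constructor
  · intro h U s
    unfold IsHomogeneous
    rw [h, weightIso_hom_app _ _ _ le_rfl]
  · intro h
    apply pullback_hom_ext
    intro U s
    rw [weightIso_hom_app _ _ _ (actLeft_preimage hX U).le]
    exact (h U s).app_psec _ _

lemma pullHom_psec_smul {X Y Z : Scheme.{u}} (h : Y ⟶ Z) {f g : Z ⟶ X} {M N : X.Modules}
    (φ : (Scheme.Modules.pullback f).obj M ⟶ (Scheme.Modules.pullback g).obj N) {a b : Y ⟶ X}
    (ha : h ≫ f = a) (hb : h ≫ g = b) {U U' : X.Opens} {V : Z.Opens} {W : Y.Opens}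
    (hV : V ≤ f ⁻¹ᵁ U) (hV' : V ≤ g ⁻¹ᵁ U') (hW : W ≤ h ⁻¹ᵁ V) (s : Γ(M, U))
    (r : Γ(Z, V)) (n : Γ(N, U')) (hs : φ.app V (psec f hV s) = r • psec g hV' n)
    (hWa : W ≤ a ⁻¹ᵁ U) (hWb : W ≤ b ⁻¹ᵁ U') :
    (pullHom h φ ha hb).app W (psec a hWa s) = pbO h hW r • psec b hWb n := by
  subst ha hb
  refine (pullHom_psec h φ rfl rfl hV hW s hWa).trans ?_
  rw [hs, psec_smul, Hom.app_smul]
  congr 1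
  have e1 := pullbackComp_psec h g hV' hW n
  have e2 := pullbackCongr_psec (rfl : h ≫ g = h ≫ g) (hW.trans (h.preimage_mono hV')) n
  rw [← e2, ← e1]
  rfl

/-- On points `(g, g', x)` the three maps to `T` are `g g'`, `g` and `g'`. -/
lemma cocycleMul_fst : cocycleMul T X ≫ fst T X =
    (cocycleAct T X ≫ fst T X) * (cocycleProj T X ≫ fst T X) := by
  rw [Hom.mul_def]
  simp

lemma chiOn_cocycle (l : Fin t → ℤ) (W : ((T ⊗ T) ⊗ X).left.Opens) :
    chiOn e (cocycleMul T X ≫ fst T X) l W =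
      chiOn e (cocycleProj T X ≫ fst T X) l W * chiOn e (cocycleAct T X ≫ fst T X) l W := by
  rw [cocycleMul_fst, chiOn_mul, mul_comm]

variable (e hX l) in
/-- The equivariant structure of weight `l` on a module. -/
def ofWeight (M : X.left.Modules) : EquivariantModule T X where
  obj := M
  φ := weightIso e hX l M
  cocycle := by
    apply pullback_hom_ext
    intro U s
    set W := ((cocycleMul T X).left ≫ actLeft T X) ⁻¹ᵁ U with hW
    have hWp : W ≤ ((cocycleMul T X).left ≫ projLeft T X) ⁻¹ᵁ U := by rw [hW, actLeft_eq hX]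
    have hWq : W ≤ ((cocycleAct T X).left ≫ projLeft T X) ⁻¹ᵁ U := by
      rw [hW, ← actLeft_eq hX, cocycleAct_actMap]
    have hWr : W ≤ ((cocycleProj T X).left ≫ projLeft T X) ⁻¹ᵁ U := by
      rw [cocycleProj_projLeft]; exact hWp
    have hle := (actLeft_preimage hX U).ge
    rw [pullHom_psec_smul _ _ rfl rfl hle le_rfl hWp s _ s (weightIso_hom_app _ _ _ _) _ hWp,
      Hom.comp_app, AddCommGrpCat.comp_apply,
      pullHom_psec_smul _ _ (cocycleAct_actMap T X) rfl hle le_rfl hWq s _ s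
        (weightIso_hom_app _ _ _ _) _ hWq, Hom.app_smul,
      pullHom_psec_smul _ _ (cocycleProj_actMap T X) (cocycleProj_projLeft T X) hle le_rfl hWr s _ s
        (weightIso_hom_app _ _ _ _) _ hWp, smul_smul]
    -- What remains is multiplicativity of the character, `χ(g g') = χ(g) χ(g')`.
    congr 1
    refine (pbO_chiOn e (cocycleMul T X) (fst T X) l hWp).trans ?_
    rw [chiOn_cocycle, mul_comm]
    exact congr_arg₂ _ (pbO_chiOn e (cocycleAct T X) (fst T X) l hWq).symm
      (pbO_chiOn e (cocycleProj T X) (fst T X) l hWr).symm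

lemma isConcentrated_ofWeight (M : X.left.Modules) : IsConcentrated e hX l (ofWeight e hX l M) :=
  isConcentrated_iff_hom_eq.2 rfl

/-- Both composites send a pulled back section `s` to `χ_l` times the pullback of `f s`. Hence
linear maps between modules of the same weight are automatically equivariant. -/
lemma comm_of_isHomogeneous (f : M.obj ⟶ N.obj) (hM : IsConcentrated e hX l M)
    (h : ∀ (U : X.left.Opens) (s : Γ(M.obj, U)), IsHomogeneous e hX N l (f.app U s)) :
    (actPull T X).map f ≫ N.φ.hom = M.φ.hom ≫ (projPull T X).map f := by
  apply pullback_hom_ext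
  intro U s
  have hle := (actLeft_preimage hX U).le
  rw [Hom.comp_app, Hom.comp_app, AddCommGrpCat.comp_apply, AddCommGrpCat.comp_apply, app_psec,
    (h U s).app_psec _ hle, (isConcentrated_iff.1 hM U s).app_psec _ hle, Hom.app_smul, app_psec]

lemma comm_of_isConcentrated (f : M.obj ⟶ N.obj) (hM : IsConcentrated e hX l M)
    (hN : IsConcentrated e hX l N) :
    (actPull T X).map f ≫ N.φ.hom = M.φ.hom ≫ (projPull T X).map f :=
  comm_of_isHomogeneous f hM fun U _ => isConcentrated_iff.1 hN U _

end Homogeneous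
end TorusPerf
end

/-! ### Splitting sections into homogeneous components. -/

noncomputable section

namespace TorusPerf

open Scheme.Modules

lemma comp_app_apply {X : Scheme.{u}} {M N P : X.Modules} (φ : M ⟶ N) (ψ : N ⟶ P) (U : X.Opens)
    (s : Γ(M, U)) : (φ ≫ ψ).app U s = ψ.app U (φ.app U s) := by
  rw [Hom.comp_app, AddCommGrpCat.comp_apply]

lemma app_sum_smul {X : Scheme.{u}} {M N : X.Modules} (φ : M ⟶ N) {U : X.Opens} {J : Type*}
    (F : Finset J) (r : J → Γ(X, U)) (s : J → Γ(M, U)) :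
    φ.app U (∑ i ∈ F, r i • s i) = ∑ i ∈ F, r i • φ.app U (s i) := by
  simp only [map_sum, Hom.app_smul]

/-- The linear algebra of the cocycle condition: evaluate `ρ = α ≫ β` at `x` and cancel the
injective map `δ`, which stands for an identification of pullbacks. -/
lemma sum_smul_eq_of_comp {X : Scheme.{u}} {A B C D : X.Modules} {ρ : A ⟶ C} {α : A ⟶ B} {β : B ⟶ C}
    (h : ρ = α ≫ β) (δ : D ⟶ C) {U : X.Opens} (hi : Function.Injective (δ.app U)) {J : Type*}
    (F : Finset J) (r r' : J → Γ(X, U)) (y : J → Γ(B, U)) (c : J → Γ(C, U)) (z w : J → Γ(D, U))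
    (x : Γ(A, U)) (e₁ : ρ.app U x = ∑ i ∈ F, r i • c i) (e₂ : α.app U x = ∑ i ∈ F, r' i • y i)
    (e₃ : ∀ i, δ.app U (z i) = c i) (e₄ : ∀ i, β.app U (y i) = δ.app U (w i)) :
    ∑ i ∈ F, r' i • w i = ∑ i ∈ F, r i • z i := by
  apply hi
  rw [app_sum_smul, app_sum_smul]
  simp only [e₃, ← e₄]
  rw [← app_sum_smul, ← e₂, ← comp_app_apply, ← h, ← e₁]

/-- The cocycle condition evaluated at a section with `φ(x) = ∑ r i n i`: coassociativity of the
coaction, with both sides brought into the pullback along `p`. -/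
lemma pullHom_cocycle_sum {X Y Z : Scheme.{u}} {m a p : Y ⟶ Z} {f g : Z ⟶ X} {M : X.Modules}
    {φ : (Scheme.Modules.pullback f).obj M ⟶ (Scheme.Modules.pullback g).obj M}
    {h₁ : a ≫ f = m ≫ f} {h₂ : p ≫ f = a ≫ g} {h₃ : p ≫ g = m ≫ g}
    (hφ : pullHom m φ rfl rfl = pullHom a φ h₁ rfl ≫ pullHom p φ h₂ h₃) {U : X.Opens} {V : Z.Opens}
    {W : Y.Opens} (hf : V ≤ f ⁻¹ᵁ U) (hg : V ≤ g ⁻¹ᵁ U) (hm : W ≤ m ⁻¹ᵁ V) (ha : W ≤ a ⁻¹ᵁ V)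
    (hp : W ≤ p ⁻¹ᵁ V) (x : Γ(M, U)) {J : Type*} (F : Finset J) (r : J → Γ(Z, V))
    (n : J → Γ(M, U)) (hx : φ.app V (psec f hf x) = ∑ i ∈ F, r i • psec g hg (n i)) :
    ∑ i ∈ F, pbO a ha (r i) • psec p hp (φ.app V (psec f hf (n i))) =
      ∑ i ∈ F, pbO m hm (r i) • psec p hp (psec g hg (n i)) := by
  have hWf : W ≤ (m ≫ f) ⁻¹ᵁ U := hm.trans (m.preimage_mono hf)
  have hWg : W ≤ (m ≫ g) ⁻¹ᵁ U := hm.trans (m.preimage_mono hg)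
  have hWa : W ≤ (a ≫ g) ⁻¹ᵁ U := ha.trans (a.preimage_mono hg)
  have e1 := pullHom_psec_sum m φ rfl rfl hf hg hm x F r n hx hWf hWg
  have e2 := pullHom_psec_sum a φ h₁ rfl hf hg ha x F r n hx hWf hWa
  have e3 (y : Γ(M, U)) : ((pullbackComp p g).hom.app M ≫ (pullbackCongr h₃).hom.app M).app W
      (psec p hp (psec g hg y)) = psec (m ≫ g) hWg y := by
    rw [comp_app_apply, pullbackComp_psec, pullbackCongr_psec]
  have e4 (y : Γ(M, U)) := pullHom_psec p φ h₂ h₃ hf hp y hWa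
  have hi : Function.Injective
      (((pullbackComp p g).hom.app M ≫ (pullbackCongr h₃).hom.app M).app W) := by
    rw [← Iso.app_hom, ← Iso.app_hom, ← Iso.trans_hom]
    exact (bijective_app_of_isIso _ W).1
  obtain ⟨ra, hra⟩ : ∃ ra : J → Γ(Y, W), ∀ i, pbO a ha (r i) = ra i := ⟨_, fun _ => rfl⟩
  obtain ⟨rm, hrm⟩ : ∃ rm : J → Γ(Y, W), ∀ i, pbO m hm (r i) = rm i := ⟨_, fun _ => rfl⟩
  obtain ⟨y, hy⟩ : ∃ y : J → Γ((Scheme.Modules.pullback (a ≫ g)).obj M, W),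
    ∀ i, psec (a ≫ g) hWa (n i) = y i := ⟨_, fun _ => rfl⟩
  obtain ⟨c, hc⟩ : ∃ c : J → Γ((Scheme.Modules.pullback (m ≫ g)).obj M, W),
    ∀ i, psec (m ≫ g) hWg (n i) = c i := ⟨_, fun _ => rfl⟩
  obtain ⟨z, hz⟩ : ∃ z : J → Γ((Scheme.Modules.pullback p).obj _, W),
    ∀ i, psec p hp (psec g hg (n i)) = z i := ⟨_, fun _ => rfl⟩
  obtain ⟨w, hw⟩ : ∃ w : J → Γ((Scheme.Modules.pullback p).obj _, W),
    ∀ i, psec p hp (φ.app V (psec f hf (n i))) = w i := ⟨_, fun _ => rfl⟩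
  replace e3 (i : J) := e3 (n i)
  replace e4 (i : J) := e4 (n i)
  simp only [hra, hrm, hy, hz, hw, hc] at e1 e2 e3 e4 ⊢
  exact sum_smul_eq_of_comp hφ _ hi F rm ra y c z w _ e1 e2 e3 e4

section Decompose

variable {S : Scheme.{u}} {T : Over S} [GrpObj T] {t : ℕ} (e : TorusSplitting T t)
variable {X Y : Over S} {J : Type u} [Fintype J]

section

variable (τ : Y ⟶ T) (f : Y ⟶ X) [IsIso (lift τ f)] {M : X.left.Modules} {U : X.left.Opens}
  {V : Y.left.Opens} {s : J → Γ(M, U)}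

/-- Expanding the `n l` in the frame, whose pullback is again a frame, reduces this to independence
of characters in each coordinate. -/
lemma IsFrame.eq_zero_of_sum_chiOn_smul_psec (hs : IsFrame s) (hV : V = f.left ⁻¹ᵁ U)
    (F : Finset (Fin t → ℤ)) (n : (Fin t → ℤ) → Γ(M, U))
    (h : ∑ l ∈ F, chiOn e τ l V • TorusPerf.psec f.left hV.le (n l) = 0) :
    ∀ l ∈ F, n l = 0 := by
  choose a ha using fun l => hs.exists_eq_sum le_rfl (n l)
  simp only [res_self] at ha
  have h1 : ∑ i, (∑ l ∈ F, pbO f.left hV.le (a l i) * chiOn e τ l V) •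
      TorusPerf.res _ le_rfl (TorusPerf.psec f.left hV.le (s i)) = 0 := by
    rw [← h]
    simp only [Finset.sum_smul, res_self]
    rw [Finset.sum_comm]
    refine Finset.sum_congr rfl fun l _ => ?_
    rw [ha l, map_sum, Finset.smul_sum]
    refine Finset.sum_congr rfl fun i _ => ?_
    rw [psec_smul, smul_smul, mul_comm]
  intro l hl
  rw [ha l]
  refine Finset.sum_eq_zero fun i _ => ?_
  have h2 := (hs.psec f.left hV.le).eq_zero le_rfl _ h1 i
  have h3 := eq_zero_of_sum_chiOn e τ f hV (Finsupp.indicator F fun l _ => a l i) (by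
    rw [Finsupp.sum_indicator_index _ (by simp)]
    exact h2)
  have h4 := DFunLike.congr_fun h3 l
  rw [Finsupp.indicator_of_mem hl] at h4
  rw [h4, Finsupp.zero_apply, zero_smul]

lemma IsFrame.exists_eq_sum_chiOn_smul_psec (hs : IsFrame s) (hU : IsAffineOpen U)
    (b : Γ((Scheme.Modules.pullback f.left).obj M, f.left ⁻¹ᵁ U)) :
    ∃ (F : Finset (Fin t → ℤ)) (n : (Fin t → ℤ) → Γ(M, U)),
      b = ∑ l ∈ F, chiOn e τ l (f.left ⁻¹ᵁ U) • TorusPerf.psec f.left le_rfl (n l) := by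
  classical
  obtain ⟨c, rfl⟩ := (hs.psec f.left le_rfl).exists_eq_sum le_rfl b
  choose a ha using fun i => exists_eq_sum_chiOn e τ f hU (c i)
  refine ⟨Finset.univ.biUnion fun i => (a i).support, fun l => ∑ i, a i l • s i, ?_⟩
  simp only [map_sum, Finset.smul_sum, psec_smul, res_self]
  rw [Finset.sum_comm]
  refine Finset.sum_congr rfl fun i _ => ?_
  rw [ha i, Finsupp.sum_of_support_subset (s := Finset.univ.biUnion fun i => (a i).support) _
    (Finset.subset_biUnion_of_mem (fun i => (a i).support) (Finset.mem_univ i)) _ (by simp),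
    Finset.sum_smul]
  refine Finset.sum_congr rfl fun l _ => ?_
  rw [smul_smul, mul_comm]

end

variable [ModObj T X]

instance (X : Over S) : IsIso (lift (fst T X) (snd T X)) := by
  rw [lift_fst_snd]; infer_instance

/-- Exhibits `T × T × X` as a torus over `T × X`, with torus coordinate `g` and base point `(g',
x)`. Independence of characters thus also applies over the base `T × X`. -/
instance : IsIso (lift (cocycleAct T X ≫ fst T X) (cocycleProj T X)) := by
  have : lift (cocycleAct T X ≫ fst T X) (cocycleProj T X) = (α_ T T X).hom := by
    ext <;> simp
  rw [this]; infer_instance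

variable {hX : IsTrivialAction T X} {M : EquivariantModule T X} {U : X.left.Opens}
  {s : J → Γ(M.obj, U)}

variable {e} in
lemma IsHomogeneous.eq_zero (hs : IsFrame s) {l m : Fin t → ℤ} (hlm : l ≠ m) {x : Γ(M.obj, U)}
    (hl : IsHomogeneous e hX M l x) (hm : IsHomogeneous e hX M m x) : x = 0 := by
  have h := hl.symm.trans hm
  -- The two weights give the relation `χ_l x - χ_m x = 0` between distinct characters.
  refine hs.eq_zero_of_sum_chiOn_smul_psec e (fst T X) (snd T X) rfl {l, m}
    (fun k => if k = l then x else -x) ?_ l (by simp) |> fun h => by simpa using h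
  rw [Finset.sum_pair hlm, if_pos rfl, if_neg hlm.symm, map_neg, smul_neg, h, add_neg_cancel]

/-- The pullback of `x` is `x` times the trivial character, so this is independence for the single
weight `0`. -/
lemma IsFrame.psec_injective {t : ℕ} (e : TorusSplitting T t) (hs : IsFrame s) {x : Γ(M.obj, U)}
    (hx : TorusPerf.psec (projLeft T X) (V := projLeft T X ⁻¹ᵁ U) le_rfl x = 0) : x = 0 := by
  refine hs.eq_zero_of_sum_chiOn_smul_psec e (fst T X) (snd T X) rfl {0} (fun _ => x) ?_ 0 (by simp)
  rw [Finset.sum_singleton]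
  exact (congrArg _ hx).trans (smul_zero _)

/-- The cocycle condition gives `∑ χ_l(g) (φ(n_l) - χ_l(g') n_l) = 0` on `T × T × X`. Independence
of the characters of `g` over `T × X` kills every bracket. -/
lemma IsFrame.isHomogeneous_of_eq_sum (hs : IsFrame s) (x : Γ(M.obj, U))
    (F : Finset (Fin t → ℤ)) (n : (Fin t → ℤ) → Γ(M.obj, U))
    (hx : M.φ.hom.app (projLeft T X ⁻¹ᵁ U) (TorusPerf.psec (actLeft T X) (actLeft_preimage hX U).ge x) =
      ∑ l ∈ F, chiOn e (fst T X) l (projLeft T X ⁻¹ᵁ U) • TorusPerf.psec (projLeft T X) le_rfl (n l)) :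
    ∀ l ∈ F, IsHomogeneous e hX M l (n l) := by
  have hle := (actLeft_preimage hX U).ge
  have hWm : (cocycleProj T X).left ⁻¹ᵁ projLeft T X ⁻¹ᵁ U ≤
      (cocycleMul T X).left ⁻¹ᵁ projLeft T X ⁻¹ᵁ U := by
    rw [← Scheme.Hom.comp_preimage, cocycleProj_projLeft]; rfl
  have hWa : (cocycleProj T X).left ⁻¹ᵁ projLeft T X ⁻¹ᵁ U ≤
      (cocycleAct T X).left ⁻¹ᵁ projLeft T X ⁻¹ᵁ U := by
    rw [← Scheme.Hom.comp_preimage, ← Scheme.Hom.comp_preimage, ← cocycleProj_actMap,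
      ← actLeft_eq hX]
  have c := pullHom_cocycle_sum M.cocycle hle le_rfl hWm hWa le_rfl x F _ n hx
  have h0 := (hs.psec (projLeft T X) le_rfl).eq_zero_of_sum_chiOn_smul_psec e
    (cocycleAct T X ≫ fst T X) (cocycleProj T X) rfl F
    (fun l => M.φ.hom.app (projLeft T X ⁻¹ᵁ U) (TorusPerf.psec (actLeft T X) hle (n l)) -
      chiOn e (fst T X) l (projLeft T X ⁻¹ᵁ U) • TorusPerf.psec (projLeft T X) le_rfl (n l)) (by
    simp only [map_sub, smul_sub, Finset.sum_sub_distrib]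
    rw [sub_eq_zero]
    refine (Finset.sum_congr rfl fun l _ => ?_).trans (c.trans (Finset.sum_congr rfl fun l _ => ?_))
    · exact congr_arg₂ _ (pbO_chiOn e (cocycleAct T X) (fst T X) l hWa).symm rfl
    · rw [psec_smul, smul_smul]
      refine congr_arg₂ _ ?_ rfl
      refine (pbO_chiOn e (cocycleMul T X) (fst T X) l hWm).trans ?_
      rw [chiOn_cocycle, mul_comm]
      exact congr_arg _ (pbO_chiOn e (cocycleProj T X) (fst T X) l le_rfl).symm)
  exact fun l hl => sub_eq_zero.1 (h0 l hl)

variable (hX) in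
/-- Sections over affine opens on which the module is free are sums of homogeneous sections. -/
lemma IsFrame.exists_isHomogeneous (hs : IsFrame s) (hU : IsAffineOpen U) (x : Γ(M.obj, U)) :
    ∃ (F : Finset (Fin t → ℤ)) (n : (Fin t → ℤ) → Γ(M.obj, U)), x = ∑ l ∈ F, n l ∧
      ∀ l ∈ F, IsHomogeneous e hX M l (n l) := by
  obtain ⟨F, n, h⟩ := hs.exists_eq_sum_chiOn_smul_psec e (fst T X) (snd T X) hU
    (M.φ.hom.app (projLeft T X ⁻¹ᵁ U) (TorusPerf.psec (actLeft T X) (actLeft_preimage hX U).ge x))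
  have hn := hs.isHomogeneous_of_eq_sum (hX := hX) e x F n h
  -- Instead of evaluating at the unit of `T`: by homogeneity `φ` kills the pullback of `x - ∑ n l`.
  -- As `φ` is an isomorphism the pullback itself is zero, and pulling back along the projection is
  -- injective.
  refine ⟨F, n, sub_eq_zero.1 (hs.psec_injective e ?_), hn⟩
  have h1 : M.φ.hom.app (projLeft T X ⁻¹ᵁ U) (TorusPerf.psec (actLeft T X)
      (actLeft_preimage hX U).ge (x - ∑ l ∈ F, n l)) = 0 := by
    rw [map_sub, map_sub, map_sum, map_sum, sub_eq_zero, h]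
    exact Finset.sum_congr rfl fun l hl => (hn l hl).symm
  have h2 := (bijective_app_of_isIso M.φ.hom (projLeft T X ⁻¹ᵁ U)).1 (h1.trans (map_zero _).symm)
  rw [← pullbackCongr_psec (actLeft_eq hX) (actLeft_preimage hX U).ge, h2, map_zero]

end Decompose
end TorusPerf
end

/-! ### Frames of homogeneous sections. -/

noncomputable section

namespace TorusPerf

open Scheme.Modules

/-- Vectors whose span contains the standard basis still span after passing to the field `k`, so a
basis of `k ^ J` can be chosen among their images. -/
lemma exists_det_map_ne_zero {A k K J : Type*} [CommRing A] [Field k] [Fintype J] [DecidableEq J]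
    (ev : A →+* k) (v : K → J → A)
    (hv : ∀ j, (Pi.single j 1 : J → A) ∈ Submodule.span A (Set.range v)) :
    ∃ c : J → K, ev (Matrix.of fun j => v (c j)).det ≠ 0 := by
  have hspan : ⊤ ≤ Submodule.span k (Set.range fun i => ev ∘ v i) := by
    have key : ∀ w ∈ Submodule.span A (Set.range v),
        ev ∘ w ∈ Submodule.span k (Set.range fun i => ev ∘ v i) := by
      intro w hw
      induction hw using Submodule.span_induction with
      | mem w hw =>
        obtain ⟨i, rfl⟩ := hw
        exact Submodule.subset_span ⟨i, rfl⟩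
      | zero => convert Submodule.zero_mem _; ext; simp
      | add w w' _ _ h h' => convert Submodule.add_mem _ h h'; ext; simp
      | smul a w _ h => convert Submodule.smul_mem _ (ev a) h; ext; simp
    rw [← (Pi.basisFun k J).span_eq, Submodule.span_le]
    rintro _ ⟨j, rfl⟩
    have h : Pi.basisFun k J j = ev ∘ Pi.single j 1 := by
      ext i
      by_cases h : i = j <;> simp [h]
    exact h ▸ key _ (hv j)
  obtain ⟨I, a, -, hsp, hli⟩ := exists_linearIndependent' k fun i => ev ∘ v i
  let b := Module.Basis.mk hli (hsp ▸ hspan)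
  let σ := (Pi.basisFun k J).indexEquiv b
  refine ⟨a ∘ σ, ?_⟩
  rw [RingHom.map_det, ← isUnit_iff_ne_zero, ← Matrix.isUnit_iff_isUnit_det,
    ← Matrix.linearIndependent_rows_iff_isUnit]
  exact hli.comp σ σ.injective

section

variable {X : Scheme.{u}} {M : X.Modules} {U : X.Opens} {J : Type*} [Fintype J] [DecidableEq J]

lemma IsFrame.of_isUnit_det {s s' : J → Γ(M, U)} (hs : IsFrame s) (B : Matrix J J Γ(X, U))
    (hB : IsUnit B.det) (h : ∀ j, s' j = ∑ i, B j i • s i) : IsFrame s' := by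
  intro V hV
  let BV := B.map (resO hV)
  have hBV : IsUnit BV := by
    rw [Matrix.isUnit_iff_isUnit_det]
    have := hB.map (resO hV)
    rwa [RingHom.map_det] at this
  have h1 : Function.Bijective fun a : J → Γ(X, V) => Matrix.vecMul a BV :=
    ⟨Matrix.vecMul_injective_of_isUnit hBV, Matrix.vecMul_surjective_iff_isUnit.2 hBV⟩
  have h2 : (fun a : J → Γ(X, V) => ∑ j, a j • TorusPerf.res M hV (s' j)) =
      (fun a : J → Γ(X, V) => ∑ j, a j • TorusPerf.res M hV (s j)) ∘
        fun a : J → Γ(X, V) => Matrix.vecMul a BV := by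
    ext a
    simp only [Function.comp_apply, h, map_sum, res_smul, Finset.smul_sum, Matrix.vecMul,
      dotProduct, Finset.sum_smul, smul_smul]
    rw [Finset.sum_comm]
    rfl
  rw [h2]
  exact (hs V hV).comp h1

end

variable {S : Scheme.{u}} {T : Over S} [GrpObj T] {t : ℕ} (e : TorusSplitting T t)
variable {X : Over S} [ModObj T X]

/-- Around every point there are frames that consist of homogeneous sections. -/
lemma exists_homogeneous_frame (hX : IsTrivialAction T X) {M : EquivariantModule T X}
    (hM : IsFiniteLocallyFree M.obj) (x : X.left) :
    ∃ (V : X.left.Opens) (_ : x ∈ V) (n : ℕ) (s : ULift.{u} (Fin n) → Γ(M.obj, V))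
      (m : ULift.{u} (Fin n) → Fin t → ℤ), IsFrame s ∧ ∀ j, IsHomogeneous e hX M (m j) (s j) := by
  obtain ⟨U', hxU', n, s', hs'⟩ := isFiniteLocallyFree_iff.1 hM x
  obtain ⟨U, hU, hxU, hUU'⟩ := exists_affine_le hxU'
  have hs := hs'.res hUU'
  set s := fun i => TorusPerf.res M.obj hUU' (s' i)
  choose F y hy hF using fun j => hs.exists_isHomogeneous e hX hU (s j)
  choose B hB using fun (j) (l : Fin t → ℤ) => hs.exists_eq_sum le_rfl (y j l)
  simp only [res_self] at hB
  -- The candidates are all homogeneous components of all the `s j`. Their coordinate vectors span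
  -- because `s j` is the sum of its components.
  let K := Σ j, F j
  obtain ⟨c, hc⟩ := exists_det_map_ne_zero (X.left.evaluation U x hxU).hom
    (fun k : K => B k.1 k.2) (fun j => by
      have h1 : (Pi.single j 1 : ULift.{u} (Fin n) → Γ(X.left, U)) = ∑ l ∈ F j, B j l := by
        have h2 := hs.eq_zero le_rfl (Pi.single j 1 - ∑ l ∈ F j, B j l) (by
          simp only [res_self, Pi.sub_apply, sub_smul, Finset.sum_sub_distrib, Finset.sum_apply,
            Finset.sum_smul]
          rw [Finset.sum_comm, sub_eq_zero]
          simp only [← hB, ← hy]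
          simp [Pi.single_apply, ite_smul])
        exact sub_eq_zero.1 (funext h2)
      rw [h1]
      exact Submodule.sum_mem _ fun l hl => Submodule.subset_span ⟨⟨j, l, hl⟩, rfl⟩)
  -- The chosen components form a frame where this determinant is invertible, a neighbourhood of `x`
  -- because `d` does not vanish at `x`.
  set d := (Matrix.of fun j => B (c j).1 (c j).2).det
  have hd : X.left.basicOpen d ≤ U := X.left.basicOpen_le d
  refine ⟨X.left.basicOpen d, (X.left.evaluation_ne_zero_iff_mem_basicOpen x hxU d).1 hc, n,
    fun j => TorusPerf.res _ hd (y (c j).1 (c j).2), fun j => (c j).2, ?_,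
    fun j => (hF _ _ (c j).2.2).res hd⟩
  refine (hs.res hd).of_isUnit_det ((Matrix.of fun j => B (c j).1 (c j).2).map (resO hd)) ?_ ?_
  · have := X.left.toRingedSpace.isUnit_res_basicOpen d
    rw [← RingHom.mapMatrix_apply, ← RingHom.map_det]
    exact this
  · intro j
    conv_lhs => rw [hB (c j).1 (c j).2]
    simp only [map_sum, res_smul]
    rfl

end TorusPerf
end

/-! ### Weight parts of an equivariant module. -/

noncomputable section

namespace TorusPerf

open Scheme.Modules

section Sections

variable {X : Scheme.{u}}

lemma app_injective_of_mono {M N : X.Modules} (φ : M ⟶ N) [Mono φ] (U : X.Opens) :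
    Function.Injective (φ.app U) := by
  let F := toPresheaf X ⋙ (evaluation _ _).obj (.op U)
  have : PreservesLimitsOfShape WalkingCospan F :=
    have := evaluation_preservesLimitsOfShape (K := X.Opensᵒᵖ) (C := Ab.{u}) (J := WalkingCospan) (.op U)
    comp_preservesLimitsOfShape _ _
  exact (AddCommGrpCat.mono_iff_injective _).1 (inferInstanceAs (Mono (F.map φ)))

/-- Taking sections over `U` is left exact. -/
lemma exists_kernel_app_eq {M N : X.Modules} (d : M ⟶ N) {U : X.Opens} (s : Γ(M, U))
    (h : d.app U s = 0) : ∃ z : Γ(kernel d, U), (kernel.ι d).app U z = s := by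
  let F := toPresheaf X ⋙ (evaluation _ _).obj (.op U)
  have : PreservesLimitsOfShape WalkingParallelPair F :=
    have := evaluation_preservesLimitsOfShape (K := X.Opensᵒᵖ) (C := Ab.{u}) (J := WalkingParallelPair) (.op U)
    comp_preservesLimitsOfShape _ _
  have : F.PreservesZeroMorphisms := ⟨fun _ _ => rfl⟩
  let C : ShortComplex X.Modules := ⟨kernel.ι d, d, kernel.condition d⟩
  have hC : C.Exact := C.exact_of_f_is_kernel (kernelIsKernel d)
  have : Mono C.f := inferInstanceAs (Mono (kernel.ι d))
  exact (ShortComplex.ab_exact_iff _).1 (hC.map_of_mono_of_preservesKernel F this inferInstance) s h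

lemma sum_app_apply {M N : X.Modules} {J : Type*} (F : Finset J) (φ : J → (M ⟶ N)) {U : X.Opens}
    (s : Γ(M, U)) : (∑ i ∈ F, φ i).app U s = ∑ i ∈ F, (φ i).app U s := by
  classical
  induction F using Finset.induction_on with
  | empty => rfl
  | insert i F hi ih =>
    rw [Finset.sum_insert hi, Finset.sum_insert hi, ← ih]
    rfl

/-- Injectivity makes local preimages unique, so they glue. -/
lemma isIso_of_locally_surjective {M N : X.Modules} (φ : M ⟶ N)
    (hi : ∀ U, Function.Injective (φ.app U))
    (hs : ∀ (U : X.Opens) (s : Γ(N, U)), ∀ x ∈ U, ∃ (V : X.Opens) (h : V ≤ U) (_ : x ∈ V)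
      (z : Γ(M, V)), φ.app V z = res N h s) : IsIso φ := by
  apply isIso_of_bijective_app
  intro U
  refine ⟨hi U, ?_⟩
  let f : (⟨M.presheaf, M.isSheaf⟩ : TopCat.Sheaf Ab X) ⟶ ⟨N.presheaf, N.isSheaf⟩ :=
    ⟨φ.mapPresheaf⟩
  refine TopCat.Presheaf.app_surjective_of_injective_of_locally_surjective f U
    (fun x _ => TopCat.Presheaf.stalkFunctor_map_injective_of_app_injective hi x) fun s x hx => ?_
  obtain ⟨V, h, hxV, z, hz⟩ := hs U s x hx
  exact ⟨V, hxV, homOfLE h, z, hz⟩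

lemma IsFrame.reindex {M : X.Modules} {U : X.Opens} {I J : Type*} [Fintype I] [Fintype J]
    {s : J → Γ(M, U)} (hs : IsFrame s) (σ : I ≃ J) : IsFrame fun i => s (σ i) := by
  intro V h
  have : (fun a : I → Γ(X, V) => ∑ i, a i • TorusPerf.res M h (s (σ i))) =
      (fun a : J → Γ(X, V) => ∑ i, a i • TorusPerf.res M h (s i)) ∘
        fun a : I → Γ(X, V) => a ∘ σ.symm := by
    ext a
    refine Fintype.sum_equiv σ _ _ fun i => ?_
    simp
  rw [this]
  exact (hs V h).comp (σ.arrowCongr (Equiv.refl _)).bijective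

end Sections

variable {S : Scheme.{u}} {T : Over S} [GrpObj T] {t : ℕ} (e : TorusSplitting T t)
variable {X : Over S} [ModObj T X] {J : Type u} [Fintype J]
variable {hX : IsTrivialAction T X} {M N : EquivariantModule T X} {U : X.left.Opens}

section

variable {e} {l : Fin t → ℤ}

lemma IsHomogeneous.sub {s s' : Γ(M.obj, U)} (hs : IsHomogeneous e hX M l s)
    (hs' : IsHomogeneous e hX M l s') : IsHomogeneous e hX M l (s - s') := by
  rw [IsHomogeneous] at *
  rw [map_sub, map_sub, map_sub, hs, hs', smul_sub]

lemma IsHomogeneous.sum {J : Type*} (F : Finset J) (s : J → Γ(M.obj, U))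
    (h : ∀ j ∈ F, IsHomogeneous e hX M l (s j)) : IsHomogeneous e hX M l (∑ j ∈ F, s j) :=
  Finset.sum_induction _ _ (fun _ _ => .add) isHomogeneous_zero h

end

section Independence

/-- Applying `φ` to `∑ n l = 0` gives `∑ χ_l n_l = 0`, and characters are independent. -/
lemma IsFrame.eq_zero_of_sum_isHomogeneous {s : J → Γ(M.obj, U)} (hs : IsFrame s)
    (F : Finset (Fin t → ℤ)) (n : (Fin t → ℤ) → Γ(M.obj, U))
    (hn : ∀ l ∈ F, IsHomogeneous e hX M l (n l)) (h : ∑ l ∈ F, n l = 0) : ∀ l ∈ F, n l = 0 := by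
  refine hs.eq_zero_of_sum_chiOn_smul_psec e (fst T X) (snd T X) rfl F n ?_
  refine (Finset.sum_congr rfl fun l hl => (hn l hl).symm).trans ?_
  rw [← map_sum, ← map_sum, h, map_zero, map_zero]

variable {e} in
lemma eq_zero_of_sum_isHomogeneous (hM : IsFiniteLocallyFree M.obj)
    (F : Finset (Fin t → ℤ)) (n : (Fin t → ℤ) → Γ(M.obj, U))
    (hn : ∀ l ∈ F, IsHomogeneous e hX M l (n l)) (h : ∑ l ∈ F, n l = 0) : ∀ l ∈ F, n l = 0 := by
  intro l hl
  refine res_eq_of_locally_eq _ _ fun x hx => ?_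
  obtain ⟨V, hxV, n', s, hs⟩ := isFiniteLocallyFree_iff.1 hM x
  refine ⟨V ⊓ U, inf_le_right, ⟨hxV, hx⟩, ?_⟩
  rw [map_zero]
  exact (hs.res inf_le_left).eq_zero_of_sum_isHomogeneous e F (fun l => res _ inf_le_right (n l))
    (fun l hl => (hn l hl).res _) (by rw [← map_sum, h, map_zero]) l hl

variable {e} in
lemma IsHomogeneous.eq_zero_of_ne (hM : IsFiniteLocallyFree M.obj) {l m : Fin t → ℤ}
    (hlm : l ≠ m) {x : Γ(M.obj, U)} (hl : IsHomogeneous e hX M l x)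
    (hm : IsHomogeneous e hX M m x) : x = 0 := by
  refine res_eq_of_locally_eq _ _ fun x hx => ?_
  obtain ⟨V, hxV, n', s, hs⟩ := isFiniteLocallyFree_iff.1 hM x
  refine ⟨V ⊓ U, inf_le_right, ⟨hxV, hx⟩, ?_⟩
  rw [map_zero]
  exact (hl.res inf_le_right).eq_zero (hs.res inf_le_left) hlm (hm.res inf_le_right)

/-- The image of a section has weight `l` as the image of an equivariant map, and weight `m` as a
section of `N`. -/
lemma hom_eq_zero_of_isConcentrated (hN : IsFiniteLocallyFree N.obj) {l m : Fin t → ℤ}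
    (hlm : l ≠ m) (hMl : IsConcentrated e hX l M) (hNm : IsConcentrated e hX m N) (f : M ⟶ N) :
    f = 0 := by
  ext U s
  exact ((isConcentrated_iff.1 hMl U s).map f).eq_zero_of_ne hN hlm (isConcentrated_iff.1 hNm U _)

end Independence

section WeightKernel

variable (hX) in
/-- The difference of the structure isomorphism and the one of weight `l`. -/
def weightDefect (M : EquivariantModule T X) (l : Fin t → ℤ) :
    M.obj ⟶ (pushforward (actLeft T X)).obj ((projPull T X).obj M.obj) :=
  pullUnit (actLeft T X) M.obj ≫
    (pushforward (actLeft T X)).map (M.φ.hom - (weightIso e hX l M.obj).hom)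

lemma weightDefect_app_eq_zero_iff {l : Fin t → ℤ} {s : Γ(M.obj, U)} :
    (weightDefect e hX M l).app U s = 0 ↔
      M.φ.hom.app (actLeft T X ⁻¹ᵁ U) (psec (actLeft T X) le_rfl s) =
        (weightIso e hX l M.obj).hom.app (actLeft T X ⁻¹ᵁ U) (psec (actLeft T X) le_rfl s) := by
  rw [psec_le_rfl]
  exact sub_eq_zero (G := Γ((projPull T X).obj M.obj, actLeft T X ⁻¹ᵁ U))

variable {e} in
-- The homogeneous sections of weight `l` are thus the sections of a kernel of `𝒪_X`-modules, and so
-- form a submodule sheaf.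
lemma isHomogeneous_iff_weightDefect {l : Fin t → ℤ} {s : Γ(M.obj, U)} :
    IsHomogeneous e hX M l s ↔ (weightDefect e hX M l).app U s = 0 := by
  have hle := (actLeft_preimage hX U).le
  have hge := (actLeft_preimage hX U).ge
  rw [weightDefect_app_eq_zero_iff, weightIso_hom_app M.obj s le_rfl hle]
  constructor
  · intro h
    exact h.app_psec le_rfl hle
  · intro h
    have := congr(res _ hge $h)
    rwa [← app_res, res_psec, res_smul, res_psec, resO_chiOn] at this

variable (hX) in
/-- The part of weight `l` of an equivariant module. -/
def weightPart (M : EquivariantModule T X) (l : Fin t → ℤ) : EquivariantModule T X :=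
  ofWeight e hX l (kernel (weightDefect e hX M l))

variable (hX) in
/-- The inclusion of the underlying module of the part of weight `l`. -/
def weightPartι (M : EquivariantModule T X) (l : Fin t → ℤ) : (weightPart e hX M l).obj ⟶ M.obj :=
  kernel.ι (weightDefect e hX M l)

instance (l : Fin t → ℤ) : Mono (weightPartι e hX M l) :=
  inferInstanceAs (Mono (kernel.ι (weightDefect e hX M l)))

lemma isHomogeneous_weightPartι_app (l : Fin t → ℤ) (z : Γ((weightPart e hX M l).obj, U)) :
    IsHomogeneous e hX M l ((weightPartι e hX M l).app U z) :=
  isHomogeneous_iff_weightDefect.2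
    congr(($(kernel.condition (weightDefect e hX M l))).app U z)

variable {e} in
lemma IsHomogeneous.exists_weightPartι_app_eq {l : Fin t → ℤ} {s : Γ(M.obj, U)}
    (hs : IsHomogeneous e hX M l s) : ∃ z, (weightPartι e hX M l).app U z = s :=
  exists_kernel_app_eq _ s (isHomogeneous_iff_weightDefect.1 hs)

variable (hX) in
lemma isConcentrated_weightPart (M : EquivariantModule T X) (l : Fin t → ℤ) :
    IsConcentrated e hX l (weightPart e hX M l) := isConcentrated_ofWeight _

variable (hX) in
/-- The inclusion of the part of weight `l`. -/
def weightInclusion (M : EquivariantModule T X) (l : Fin t → ℤ) : weightPart e hX M l ⟶ M where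
  hom := weightPartι e hX M l
  comm := comm_of_isHomogeneous _ (isConcentrated_weightPart e hX M l)
    fun _ z => isHomogeneous_weightPartι_app e l z

/-- The members of weight `l` of a homogeneous frame of `M` form a frame of the weight part. -/
lemma isFiniteLocallyFree_weightPart (hM : IsFiniteLocallyFree M.obj) (l : Fin t → ℤ) :
    IsFiniteLocallyFree (weightPart e hX M l).obj := by
  classical
  rw [isFiniteLocallyFree_iff]
  intro x
  obtain ⟨V, hxV, n, s, m, hs, hm⟩ := exists_homogeneous_frame e hX hM x
  choose z hz using fun j => (hm j).exists_weightPartι_app_eq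
  let I := {j // m j = l}
  have hz' (j : I) : ∃ z, (weightPartι e hX M l).app V z = s j := by
    obtain ⟨j, rfl⟩ := j
    exact ⟨_, hz j⟩
  choose w hw using hz'
  have hsum (W : X.left.Opens) (hW : W ≤ V) (a : I → Γ(X.left, W)) :
      (weightPartι e hX M l).app W (∑ i, a i • res _ hW (w i)) =
        ∑ i : I, a i • res _ hW (s i) := by
    rw [app_sum_smul]
    simp only [app_res, hw]
  have hframe : IsFrame w := by
    refine isFrame_of (fun W hW a h => ?_) fun W hW b => ?_
    · have h1 := congrArg ((weightPartι e hX M l).app W) h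
      rw [hsum, map_zero] at h1
      have h2 := hs.eq_zero hW (fun j => if h : m j = l then a ⟨j, h⟩ else 0) (by
        rw [← h1, ← Fintype.sum_subtype_add_sum_subtype (fun j => m j = l),
          add_eq_left.2 (Finset.sum_eq_zero fun j _ => by rw [dif_neg j.2, zero_smul])]
        exact Finset.sum_congr rfl fun j _ => by rw [dif_pos j.2])
      funext i
      simpa [i.2] using h2 i
    · obtain ⟨a, ha⟩ := hs.exists_eq_sum hW ((weightPartι e hX M l).app W b)
      refine ⟨fun i => a i, app_injective_of_mono (weightPartι e hX M l) W ?_⟩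
      rw [hsum]
      -- Expand `b` in the frame, group the terms by weight and subtract `b` in weight `l`:
      -- homogeneous sections with sum zero, so the terms of weight `l` alone add up to `b`. The
      -- weight `l` is inserted because it need not occur in the frame.
      have h1 := (hs.res hW).eq_zero_of_sum_isHomogeneous e (hX := hX)
        (insert l (Finset.univ.image m))
        (fun k => ∑ j with m j = k, a j • res _ hW (s j) -
          if k = l then (weightPartι e hX M l).app W b else 0) ?_ ?_ l (by simp)
      · rw [if_pos rfl, sub_eq_zero] at h1
        rw [← h1]
        exact (Finset.sum_subtype (Finset.univ.filter fun j => m j = l) (by simp)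
          fun j => a j • res _ hW (s j)).symm
      · intro k _
        refine IsHomogeneous.sub (.sum _ _ fun j hj => ?_) ?_
        · obtain rfl := (Finset.mem_filter.1 hj).2
          exact ((hm j).res hW).smul _
        · split_ifs with hk
          · exact hk ▸ isHomogeneous_weightPartι_app e l b
          · exact isHomogeneous_zero
      · rw [Finset.sum_sub_distrib, Finset.sum_ite_eq', if_pos (by simp), sub_eq_zero, ha]
        exact Finset.sum_fiberwise_of_maps_to (by simp) _
  let σ : ULift.{u} (Fin (Fintype.card I)) ≃ I := Equiv.ulift.trans (Fintype.equivFin I).symm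
  exact ⟨V, hxV, _, _, hframe.reindex σ⟩

end WeightKernel

end TorusPerf
end

/-! ### The finite weight decomposition of an equivariant vector bundle. -/

noncomputable section

namespace TorusPerf

open Scheme.Modules

variable {S : Scheme.{u}} {T : Over S} [GrpObj T] {t : ℕ} (e : TorusSplitting T t)
variable {X : Over S} [ModObj T X] (hX : IsTrivialAction T X) {M : EquivariantModule T X}

/-- Each homogeneous frame involves finitely many weights, and finitely many of their domains cover
`X`. This is where quasi-compactness enters. -/
lemma exists_finset_homogeneous_frame [CompactSpace X.left] (hM : IsFiniteLocallyFree M.obj) :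
    ∃ F : Finset (Fin t → ℤ), ∀ x : X.left, ∃ (V : X.left.Opens) (_ : x ∈ V) (n : ℕ)
      (s : ULift.{u} (Fin n) → Γ(M.obj, V)) (m : ULift.{u} (Fin n) → Fin t → ℤ),
      IsFrame s ∧ ∀ j, m j ∈ F ∧ IsHomogeneous e hX M (m j) (s j) := by
  classical
  choose V hxV n s m hs hm using exists_homogeneous_frame e hX hM
  obtain ⟨I, hI⟩ := CompactSpace.elim_nhds_subcover (fun x => (V x : Set X.left))
    fun x => (V x).isOpen.mem_nhds (hxV x)
  refine ⟨I.biUnion fun x => Finset.univ.image (m x), fun y => ?_⟩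
  have hy : y ∈ ⋃ x ∈ I, (V x : Set X.left) := hI ▸ Set.mem_univ y
  simp only [Set.mem_iUnion] at hy
  obtain ⟨x, hxI, hyx⟩ := hy
  exact ⟨V x, hyx, n x, s x, m x, hs x, fun j =>
    ⟨Finset.mem_biUnion.2 ⟨x, hxI, Finset.mem_image_of_mem _ (Finset.mem_univ j)⟩, hm x j⟩⟩

instance (Y : Scheme.{u}) : HasFiniteBiproducts Y.Modules := Abelian.hasFiniteBiproducts

/-- The sum of the parts of finitely many weights. -/
abbrev weightSum (M : EquivariantModule T X) (F : Finset (Fin t → ℤ)) : X.left.Modules :=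
  ⨁ fun l : F => (weightPart e hX M l).obj

/-- The map from the sum of the parts of finitely many weights. -/
def weightSumDesc (M : EquivariantModule T X) (F : Finset (Fin t → ℤ)) :
    weightSum e hX M F ⟶ M.obj :=
  biproduct.desc fun l => weightPartι e hX M l

lemma weightSumDesc_app_injective (hM : IsFiniteLocallyFree M.obj) (F : Finset (Fin t → ℤ))
    (U : X.left.Opens) : Function.Injective ((weightSumDesc e hX M F).app U) := by
  rw [injective_iff_map_eq_zero]
  intro z hz
  let c (l : F) := (weightPartι e hX M l).app U
    ((biproduct.π (fun l : F => (weightPart e hX M l).obj) l).app U z)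
  have hc (l : F) : IsHomogeneous e hX M l (c l) := isHomogeneous_weightPartι_app e _ _
  have h1 : ∑ l : F, c l = 0 := by
    rw [weightSumDesc, biproduct.desc_eq, sum_app_apply] at hz
    exact hz
  have h2 (l : F) : c l = 0 := by
    have := eq_zero_of_sum_isHomogeneous hM F (fun k => if h : k ∈ F then c ⟨k, h⟩ else 0)
      (fun k hk => by rw [dif_pos hk]; exact hc ⟨k, hk⟩) (by
        rw [← h1, ← Finset.sum_coe_sort]
        exact Finset.sum_congr rfl fun k _ => by rw [dif_pos k.2]) l l.2
    simpa using this
  have h3 : z = ∑ l : F, (biproduct.ι (fun l : F => (weightPart e hX M l).obj) l).app U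
      ((biproduct.π (fun l : F => (weightPart e hX M l).obj) l).app U z) := by
    have := congr(($(biproduct.total (f := fun l : F => (weightPart e hX M l).obj))).app U z)
    rw [sum_app_apply] at this
    exact this.symm
  rw [h3]
  refine Finset.sum_eq_zero fun l _ => ?_
  rw [app_injective_of_mono (weightPartι e hX M l) U ((h2 l).trans (map_zero _).symm), map_zero]

/-- Injectivity is independence of weights; local surjectivity holds because homogeneous frames with
weights in `F` exist around every point. -/
lemma exists_isIso_weightSumDesc [CompactSpace X.left] (hM : IsFiniteLocallyFree M.obj) :
    ∃ F : Finset (Fin t → ℤ), IsIso (weightSumDesc e hX M F) := by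
  obtain ⟨F, hF⟩ := exists_finset_homogeneous_frame e hX hM
  refine ⟨F, isIso_of_locally_surjective _ (weightSumDesc_app_injective e hX hM F)
    fun U y x hx => ?_⟩
  obtain ⟨V, hxV, n, s, m, hs, hm⟩ := hF x
  have hVU : V ⊓ U ≤ U := inf_le_right
  have hVV : V ⊓ U ≤ V := inf_le_left
  obtain ⟨a, ha⟩ := hs.exists_eq_sum hVV (res _ hVU y)
  choose z hz using fun j => (((hm j).2.res hVV).smul (a j)).exists_weightPartι_app_eq
  refine ⟨V ⊓ U, hVU, ⟨hxV, hx⟩, ∑ j, (biproduct.ι (fun l : F => (weightPart e hX M l).obj)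
    ⟨m j, (hm j).1⟩).app (V ⊓ U) (z j), ?_⟩
  rw [ha, map_sum]
  refine Finset.sum_congr rfl fun j _ => ?_
  rw [← hz, ← comp_app_apply, weightSumDesc, biproduct.ι_desc]

variable (M) in
/-- Every equivariant finite locally free module is the direct sum of finitely many modules that
are concentrated in one degree. -/
theorem exists_weight_decomposition [CompactSpace X.left] (hM : IsFiniteLocallyFree M.obj) :
    ∃ (F : Finset (Fin t → ℤ)) (N : F → EquivariantModule T X) (i : ∀ l, N l ⟶ M)
      (r : ∀ l, M ⟶ N l), (∀ l, IsFiniteLocallyFree (N l).obj) ∧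
      (∀ l : F, IsConcentrated e hX l (N l)) ∧ (∀ l, i l ≫ r l = 𝟙 _) ∧ ∑ l, r l ≫ i l = 𝟙 M := by
  obtain ⟨F, hF⟩ := exists_isIso_weightSumDesc e hX hM
  let ρ (l : F) : M.obj ⟶ (weightPart e hX M l).obj :=
    inv (weightSumDesc e hX M F) ≫ biproduct.π _ l
  have hι (k : F) : weightPartι e hX M k ≫ inv (weightSumDesc e hX M F) =
      biproduct.ι (fun l : F => (weightPart e hX M l).obj) k := by
    rw [IsIso.comp_inv_eq, weightSumDesc, biproduct.ι_desc]
  have hρ (k : F) : weightPartι e hX M k ≫ ρ k = 𝟙 _ := by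
    rw [reassoc_of% hι, biproduct.ι_π_self]
  have hρ' (k l : F) (h : k ≠ l) : weightPartι e hX M k ≫ ρ l = 0 := by
    rw [reassoc_of% hι, biproduct.ι_π_ne _ h]
  have hsum : ∑ l : F, ρ l ≫ weightPartι e hX M l = 𝟙 M.obj := by
    simp only [ρ, Category.assoc, ← Preadditive.comp_sum]
    rw [← biproduct.desc_eq]
    exact IsIso.inv_hom_id _
  have hcomm (l : F) : (actPull T X).map (ρ l) ≫ (weightPart e hX M l).φ.hom =
      M.φ.hom ≫ (projPull T X).map (ρ l) := by
    -- Equivariance of the projections follows from that of the inclusions: insert the identity as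
    -- `∑ ρ k ≫ ι k`, move each `ι k` past `φ`, and only `k = l` survives the final `ρ l`.
    have h1 : 𝟙 ((actPull T X).obj M.obj) =
        ∑ k : F, (actPull T X).map (ρ k) ≫ (actPull T X).map (weightPartι e hX M k) := by
      rw [← CategoryTheory.Functor.map_id, ← hsum, Functor.map_sum]
      simp only [Functor.map_comp]
    rw [← Category.id_comp (M.φ.hom ≫ _), h1, Preadditive.sum_comp, Finset.sum_eq_single l]
    · have h2 := (weightInclusion e hX M l).comm
      rw [Category.assoc]
      erw [reassoc_of% h2]
      rw [← Functor.map_comp]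
      erw [hρ]
      rw [CategoryTheory.Functor.map_id, Category.comp_id]
    · intro k _ hk
      have h2 := (weightInclusion e hX M k).comm
      rw [Category.assoc]
      erw [reassoc_of% h2]
      rw [← Functor.map_comp]
      erw [hρ' _ _ hk]
      rw [Functor.map_zero, comp_zero, comp_zero]
    · simp
  refine ⟨F, fun l => weightPart e hX M l, fun l => weightInclusion e hX M l,
    fun l => ⟨ρ l, hcomm l⟩, fun l => isFiniteLocallyFree_weightPart e hM l,
    fun l => isConcentrated_weightPart e hX M l, fun l => ?_, ?_⟩
  · ext1
    exact hρ l
  · apply (EquivariantModule.forget T X).map_injective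
    rw [Functor.map_sum]
    exact hsum

end TorusPerf
end

/-! ### Mapping complexes: equal weights and different weights. -/

noncomputable section

namespace TorusPerf

open CochainComplex HomComplex

variable {S : Scheme.{u}} {T : Over S} [GrpObj T] {t : ℕ} (e : TorusSplitting T t)
variable {X : Over S} [ModObj T X] (hX : IsTrivialAction T X)

variable {e hX} in
/-- A morphism of the underlying modules of equivariant modules that are concentrated in the same
degree is equivariant. -/
def homOfIsConcentrated {l : Fin t → ℤ} {M N : EquivariantModule T X} (hM : IsConcentrated e hX l M)
    (hN : IsConcentrated e hX l N) (f : M.obj ⟶ N.obj) : M ⟶ N where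
  hom := f
  comm := comm_of_isConcentrated f hM hN

/-- The functor that equips finite locally free modules with the equivariant structure of
weight `l`. -/
def weightFunctor (l : Fin t → ℤ) : VectorBundle X.left ⥤ EquivariantVectorBundle T X where
  obj M := ⟨ofWeight e hX l M.obj, M.property⟩
  map f := ObjectProperty.homMk
    (homOfIsConcentrated (isConcentrated_ofWeight (e := e) (hX := hX) (l := l) _)
      (isConcentrated_ofWeight _) f.hom)

instance (l : Fin t → ℤ) : (weightFunctor e hX l).Additive where

instance : (forgetEquivariance T X).Faithful where
  map_injective h := ObjectProperty.hom_ext _ (EquivariantModule.hom_ext congr(($h).hom))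

/-- A cochain is a family of morphisms between terms, and in one weight each linear map is
equivariant. A complex on `X` lifts by giving each term the structure of weight `l`, and forgetting
returns the same terms and differentials. -/
theorem forgetWeightPart_isEquivalence (l : Fin t → ℤ) : (forgetWeightPart e hX l).IsEquivalence where
  bijective K L n := by
    constructor
    · intro f g h
      refine Cochain.ext _ _ fun p q hpq => ?_
      apply (forgetEquivariance T X).map_injective
      exact Cochain.congr_v h p q hpq
    · intro f
      refine ⟨Cochain.mk fun p q hpq => ObjectProperty.homMk
        (homOfIsConcentrated (K.property.2 p) (L.property.2 q) (Cochain.v f p q hpq).hom), ?_⟩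
      refine Cochain.ext _ _ fun p q hpq => ?_
      apply ObjectProperty.hom_ext
      rfl
  essSurj Z := by
    obtain ⟨a, b, ha, hb⟩ := Z.property
    let K : WeightPart e hX l := ⟨((weightFunctor e hX l).mapHomologicalComplex _).obj Z.obj,
      ⟨a, b, inferInstance, inferInstance⟩, fun n => isConcentrated_ofWeight _⟩
    let α : ((forgetWeightPart e hX l).obj K).obj ≅ Z.obj :=
      HomologicalComplex.Hom.isoOfComponents (fun n => Iso.refl _) (fun i j _ =>
        (Category.id_comp _).trans (Category.comp_id _).symm)
    have h₁ : δ 0 1 (Cochain.ofHom α.hom) = 0 := δ_ofHom _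
    have h₂ : δ 0 1 (Cochain.ofHom α.inv) = 0 := δ_ofHom _
    refine ⟨K, Cochain.ofHom α.hom, Cochain.ofHom α.inv, h₁, h₂, ?_, ?_⟩
    · refine (Cochain.ofHom_comp α.hom α.inv).symm.trans ?_
      rw [α.hom_inv_id]
      rfl
    · refine (Cochain.ofHom_comp α.inv α.hom).symm.trans ?_
      rw [α.inv_hom_id]
      rfl

theorem cochain_eq_zero {m l : Fin t → ℤ} (hml : m ≠ l) {K L : SPerfEquivariant T X}
    (hK : weightComplexes e hX m K.obj) (hL : weightComplexes e hX l L.obj) (n : ℤ)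
    (f : DGCategory.hom K L n) : f = 0 := by
  refine Cochain.ext _ _ fun p q hpq => ?_
  apply ObjectProperty.hom_ext
  exact hom_eq_zero_of_isConcentrated e (L.obj.X q).property hml (hK.2 p) (hL.2 q) _

end TorusPerf
end

/-! ### Bounded homotopy categories and splitting of complexes. -/

noncomputable section

namespace TorusPerf

open CochainComplex HomComplex

section Homotopy

variable {C : Type*} [Category* C] [Preadditive C]

lemma shift_obj_as (K : BoundedHomotopyCategory C) (n : ℤ) :
    (K⟦n⟧).obj.as = (CategoryTheory.shiftFunctor (CochainComplex C ℤ) n).obj K.obj.as := by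
  have h : (K⟦n⟧).obj = K.obj⟦n⟧ := by with_unfolding_all rfl
  rw [h]
  exact congrArg (fun L => L.as) (HomotopyCategory.shift_quotient_obj K.obj.as n)

/-- The bounded complexes all of whose terms satisfy `P`, in the bounded homotopy category. -/
def hoBoundedOf (P : ObjectProperty C) [HasZeroObject C] [HasBinaryBiproducts C] :
    ObjectProperty (BoundedHomotopyCategory C) := fun K =>
  boundedComplexes C K.obj.as ∧ ∀ n, P (K.obj.as.X n)

variable [HasZeroObject C] [HasBinaryBiproducts C] (P : ObjectProperty C)

instance [P.ContainsZero] [P.IsClosedUnderIsomorphisms] : (hoBoundedOf P).ContainsZero where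
  exists_zero := by
    have hz : IsZero ((HomotopyCategory.quotient C (.up ℤ)).obj 0) :=
      Functor.map_isZero _ (isZero_zero _)
    have hb : boundedComplexes C (0 : CochainComplex C ℤ) :=
      ⟨0, 0, inferInstance, inferInstance⟩
    refine ⟨⟨_, hb⟩, ?_, hb, fun n => P.prop_of_isZero ?_⟩
    · rw [IsZero.iff_id_eq_zero]
      exact ObjectProperty.hom_ext _ (hz.eq_of_src _ _)
    · exact Functor.map_isZero (HomologicalComplex.eval C (.up ℤ) n) (isZero_zero _)

instance : (hoBoundedOf P).IsStableUnderShift ℤ where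
  isStableUnderShiftBy n :=
    { le_shift K hK := by
        obtain ⟨⟨a, b, ha, hb⟩, hP⟩ := hK
        change hoBoundedOf P _
        rw [hoBoundedOf, shift_obj_as]
        exact ⟨⟨a - n, b - n, CochainComplex.isStrictlyGE_shift K.obj.as a n (a - n) (by lia),
          CochainComplex.isStrictlyLE_shift K.obj.as b n (b - n) (by lia)⟩, fun i => hP _⟩ }

/-- The third vertex is isomorphic to the mapping cone of a chain map representing the first
morphism, and the terms of a cone are direct sums of terms of the two complexes. -/
lemma hoBoundedOf_isTriangulatedClosed₃ [P.IsClosedUnderIsomorphisms]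
    (hP : ∀ A B, P A → P B → P (A ⊞ B)) : (hoBoundedOf P).IsTriangulatedClosed₃ where
  ext₃' T hT h₁ h₂ := by
    obtain ⟨⟨a₁, b₁, ha₁, hb₁⟩, hP₁⟩ := h₁
    obtain ⟨⟨a₂, b₂, ha₂, hb₂⟩, hP₂⟩ := h₂
    obtain ⟨f : T.obj₁.obj.as ⟶ T.obj₂.obj.as, hf⟩ :=
      (HomotopyCategory.quotient _ _).map_surjective T.mor₁.hom
    have hb : boundedComplexes C (mappingCone f) :=
      ⟨min (a₁ - 1) a₂, max b₁ b₂,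
        isStrictlyGE_mappingCone f a₁ a₂ _ (by simp) (by simp),
        isStrictlyLE_mappingCone f b₁ b₂ _ (by simp) (by simp)⟩
    refine ⟨⟨(HomotopyCategory.quotient _ _).obj (mappingCone f), hb⟩, ⟨hb, fun n => ?_⟩,
      ⟨ObjectProperty.isoMk _ (Triangle.π₃.mapIso (isoTriangleOfIso₁₂
        ((hoBounded C).ι.mapTriangle.obj T) _ hT
        (HomotopyCategory.mappingCone_triangleh_distinguished f)
        (Iso.refl _) (Iso.refl _) ?_))⟩⟩
    · exact P.prop_of_iso (HomologicalComplex.homotopyCofiber.XIsoBiprod f n (n + 1) rfl).symm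
        (hP _ _ (hP₁ _) (hP₂ _))
    · exact (Category.comp_id _).trans (hf.symm.trans (Category.id_comp _).symm)

lemma hoBoundedOf_isTriangulated [P.ContainsZero] [P.IsClosedUnderIsomorphisms]
    (hP : ∀ A B, P A → P B → P (A ⊞ B)) : (hoBoundedOf P).IsTriangulated where
  toIsTriangulatedClosed₂ :=
    have := hoBoundedOf_isTriangulatedClosed₃ P hP
    .of_isTriangulatedClosed₃

end Homotopy

section Decomposition

variable {C : Type*} [Category* C] [Preadditive C] {I : Type*} (P : I → ObjectProperty C)

/-- The object `M` is the direct sum of summands in `P i` for `i ∈ F`. -/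
def IsDecomposed (F : Finset I) (M : C) : Prop :=
  ∃ p : I → (M ⟶ M), (∀ l ∈ F, ∃ (N : C) (i : N ⟶ M) (r : M ⟶ N),
    P l N ∧ i ≫ r = 𝟙 N ∧ r ≫ i = p l) ∧ ∑ l ∈ F, p l = 𝟙 M

variable {P}

/-- Orthogonality makes the differential block diagonal with respect to the splittings of the terms,
so the splittings, chosen independently in each degree, are compatible with it. -/
lemma exists_complex_decomposition
    (horth : ∀ l m, l ≠ m → ∀ A B : C, P l A → P m B → ∀ f : A ⟶ B, f = 0)
    (K : CochainComplex C ℤ) (F : Finset I) (h : ∀ n, IsDecomposed P F (K.X n)) :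
    ∃ (L : F → CochainComplex C ℤ) (i : ∀ l, L l ⟶ K) (r : ∀ l, K ⟶ L l),
      (∀ (l : F) (n : ℤ), P l ((L l).X n)) ∧ (∀ l, i l ≫ r l = 𝟙 _) ∧
      (∀ l m, l ≠ m → i l ≫ r m = 0) ∧ ∑ l, r l ≫ i l = 𝟙 K := by
  choose p hp hsum using h
  choose N i r hN hir hri using fun (n : ℤ) (l : F) => hp n l l.2
  have hsum' (n : ℤ) : ∑ l : F, r n l ≫ i n l = 𝟙 (K.X n) := by
    exact (Finset.sum_congr rfl fun l _ => hri n l).trans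
      ((Finset.sum_coe_sort F (p n)).trans (hsum n))
  have hne (l m : F) (hlm : l ≠ m) {n n' : ℤ} (f : N n l ⟶ N n' m) : f = 0 :=
    horth l m (fun h => hlm (Subtype.ext h)) _ _ (hN n l) (hN n' m) f
  -- `hi` says that the differential maps the `l`-summand into the `l`-summand; `hr` is the dual
  -- statement for the projections.
  have hi (l : F) (n n' : ℤ) : i n l ≫ K.d n n' ≫ r n' l ≫ i n' l = i n l ≫ K.d n n' := by
    conv_rhs => rw [← Category.comp_id (K.d n n'), ← hsum' n', Preadditive.comp_sum,
      Preadditive.comp_sum]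
    rw [Finset.sum_eq_single l (fun m _ hm => ?_) (by simp)]
    rw [← Category.assoc, ← Category.assoc, hne l m hm.symm ((i n l ≫ _) ≫ r n' m), zero_comp]
  have hr (l : F) (n n' : ℤ) : r n l ≫ i n l ≫ K.d n n' ≫ r n' l = K.d n n' ≫ r n' l := by
    conv_rhs => rw [← Category.id_comp (K.d n n'), ← hsum' n, Preadditive.sum_comp,
      Preadditive.sum_comp]
    rw [Finset.sum_eq_single l (fun m _ hm => ?_) (by simp)]
    · simp only [Category.assoc]
    · rw [Category.assoc, Category.assoc, hne m l hm (i n m ≫ _), comp_zero]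
  refine ⟨fun l =>
    { X := fun n => N n l
      d := fun n n' => i n l ≫ K.d n n' ≫ r n' l
      shape := fun n n' hnn' => by rw [K.shape _ _ hnn', zero_comp, comp_zero]
      d_comp_d' := fun n n' n'' _ _ => by
        rw [Category.assoc, Category.assoc, hr, K.d_comp_d_assoc, zero_comp, comp_zero] },
    fun l =>
    { f := fun n => i n l
      comm' := fun n n' _ => by simp [hi] },
    fun l =>
    { f := fun n => r n l
      comm' := fun n n' _ => by simp [hr] }, fun l n => hN n l, fun l => ?_, fun l m hlm => ?_, ?_⟩
  · ext n
    exact hir n l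
  · ext n
    exact hne l m hlm _
  · ext n
    refine Eq.trans ?_ (hsum' n)
    exact (HomologicalComplex.eval C (.up ℤ) n).map_sum _ _

variable [∀ l, (P l).ContainsZero]

lemma exists_zero_summand (l : I) (M : C) : ∃ (N : C) (i : N ⟶ M) (r : M ⟶ N),
    P l N ∧ i ≫ r = 𝟙 N ∧ r ≫ i = 0 := by
  obtain ⟨Z, hZ, hP⟩ := (P l).exists_prop_of_containsZero
  exact ⟨Z, 0, 0, hP, hZ.eq_of_src _ _, zero_comp⟩

/-- New indices receive a zero summand. This lets all terms of a bounded complex share one finite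
index set. -/
lemma IsDecomposed.mono {F F' : Finset I} {M : C} (h : IsDecomposed P F M) (hF : F ⊆ F') :
    IsDecomposed P F' M := by
  classical
  obtain ⟨p, hp, hsum⟩ := h
  refine ⟨fun l => if l ∈ F then p l else 0, fun l _ => ?_, ?_⟩
  · dsimp only
    split_ifs with hl
    · exact hp l hl
    · exact exists_zero_summand l M
  · rw [← hsum, Finset.sum_ite_mem, Finset.inter_eq_right.2 hF]

lemma isDecomposed_of_isZero (F : Finset I) {M : C} (hM : IsZero M) : IsDecomposed P F M :=
  ⟨fun _ => 0, fun l _ => exists_zero_summand l M, hM.eq_of_src _ _⟩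

lemma exists_isDecomposed_of_bounded (hP : ∀ M : C, ∃ F, IsDecomposed P F M)
    {K : CochainComplex C ℤ} (hK : boundedComplexes C K) :
    ∃ F, ∀ n, IsDecomposed P F (K.X n) := by
  classical
  obtain ⟨a, b, ha, hb⟩ := hK
  choose F hF using fun n => hP (K.X n)
  refine ⟨(Finset.Icc a b).biUnion F, fun n => ?_⟩
  by_cases hn : n ∈ Finset.Icc a b
  · exact (hF n).mono (Finset.subset_biUnion_of_mem F hn)
  · apply isDecomposed_of_isZero
    rw [Finset.mem_Icc, not_and_or, not_le, not_le] at hn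
    exact hn.elim (fun h => K.isZero_of_isStrictlyGE a n h) fun h => K.isZero_of_isStrictlyLE b n h

lemma boundedComplexes_of_retract {K L : CochainComplex C ℤ} (hK : boundedComplexes C K)
    (i : L ⟶ K) (r : K ⟶ L) (h : i ≫ r = 𝟙 L) : boundedComplexes C L := by
  obtain ⟨a, b, ha, hb⟩ := hK
  have key (n : ℤ) (hn : IsZero (K.X n)) : IsZero (L.X n) := by
    rw [IsZero.iff_id_eq_zero]
    have := congr(($h).f n)
    rw [HomologicalComplex.comp_f, hn.eq_of_tgt (i.f n) 0, zero_comp] at this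
    exact this.symm
  refine ⟨a, b, ?_, ?_⟩
  · rw [isStrictlyGE_iff]
    exact fun n hn => key n (K.isZero_of_isStrictlyGE a n hn)
  · rw [isStrictlyLE_iff]
    exact fun n hn => key n (K.isZero_of_isStrictlyLE b n hn)

/-- A bounded complex is a finite direct sum of bounded complexes with terms in a single `P l`. The
quotient functor preserves this sum, and a strictly full triangulated subcategory is closed under
finite products. -/
theorem prop_of_isDecomposed [HasZeroObject C] [HasBinaryBiproducts C]
    (horth : ∀ l m, l ≠ m → ∀ A B : C, P l A → P m B → ∀ f : A ⟶ B, f = 0)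
    (hP : ∀ M : C, ∃ F, IsDecomposed P F M) (Q : ObjectProperty (BoundedHomotopyCategory C))
    [Q.IsTriangulated] [Q.IsClosedUnderIsomorphisms] (hQ : ∀ l, hoBoundedOf (P l) ≤ Q)
    (X : BoundedHomotopyCategory C) : Q X := by
  classical
  obtain ⟨X, hX⟩ := X
  obtain ⟨K : CochainComplex _ _, rfl⟩ := X.quotient_obj_surjective
  obtain ⟨F, hF⟩ := exists_isDecomposed_of_bounded hP hX
  obtain ⟨L, i, r, hL, hir, hne, hsum⟩ := exists_complex_decomposition horth K F hF
  have hb (l : F) : boundedComplexes C (L l) := boundedComplexes_of_retract hX (i l) (r l) (hir l)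
  let q := HomotopyCategory.quotient C (.up ℤ)
  let Y (l : F) : BoundedHomotopyCategory C := ⟨q.obj (L l), hb l⟩
  let b : Bicone Y :=
    ⟨⟨q.obj K, hX⟩, fun l => ObjectProperty.homMk (q.map (r l)),
      fun l => ObjectProperty.homMk (q.map (i l)), fun l m => by
        apply ObjectProperty.hom_ext
        split_ifs with h
        · subst h
          exact (q.map_comp _ _).symm.trans ((congrArg _ (hir l)).trans (q.map_id _))
        · exact (q.map_comp _ _).symm.trans ((congrArg _ (hne l m h)).trans (q.map_zero _ _))⟩
  have hbl : b.IsBilimit := isBilimitOfTotal b (by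
    apply (hoBounded C).ι.map_injective
    rw [Functor.map_sum]
    refine Eq.trans ?_ ((congrArg q.map hsum).trans (q.map_id _))
    rw [Functor.map_sum]
    exact Finset.sum_congr rfl fun l _ => (q.map_comp _ _).symm)
  exact Q.prop_of_isLimit hbl.isLimit fun ⟨l⟩ => hQ l _ ⟨hb l, hL l⟩

end Decomposition
end TorusPerf
end

/-! ### The semi-orthogonal decomposition. -/

noncomputable section

namespace TorusPerf

open Scheme.Modules

variable {S : Scheme.{u}} {T : Over S} [GrpObj T] {t : ℕ} (e : TorusSplitting T t)
variable {X : Over S} [ModObj T X] (hX : IsTrivialAction T X)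

variable {e hX} in
-- Every section is a sum of images of sections of weight `l`. One index gives closure under
-- isomorphism, none gives the zero object, two give direct sums.
lemma isConcentrated_of_comp_eq_id {l : Fin t → ℤ} {J : Type*} {M : EquivariantModule T X}
    {N : J → EquivariantModule T X} (F : Finset J) (hN : ∀ j, IsConcentrated e hX l (N j))
    (r : ∀ j, M ⟶ N j) (i : ∀ j, N j ⟶ M) (h : ∑ j ∈ F, (r j ≫ i j).hom = 𝟙 M.obj) :
    IsConcentrated e hX l M := by
  rw [isConcentrated_iff]
  intro U s
  have hs : s = ∑ j ∈ F, (i j).hom.app U ((r j).hom.app U s) := by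
    have := congr(($h).app U s)
    rw [sum_app_apply] at this
    exact this.symm
  rw [hs]
  exact .sum _ _ fun j _ => (isConcentrated_iff.1 (hN j) U _).map (i j)

/-- The equivariant finite locally free modules that are concentrated in one degree. -/
def concentrated (l : Fin t → ℤ) : ObjectProperty (EquivariantVectorBundle T X) := fun M =>
  IsConcentrated e hX l M.obj

instance (l : Fin t → ℤ) : (concentrated e hX l).IsClosedUnderIsomorphisms where
  of_iso {M N} f hM := isConcentrated_of_comp_eq_id (N := fun _ : Unit => M.obj) {()} (fun _ => hM)
    (fun _ => f.inv.hom) (fun _ => f.hom.hom) (by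
      rw [Finset.sum_singleton]
      exact congr(($(f.inv_hom_id)).hom.hom))

instance (l : Fin t → ℤ) : (concentrated e hX l).ContainsZero where
  exists_zero := ⟨0, isZero_zero _, isConcentrated_of_comp_eq_id (J := Empty)
    (N := nofun) ∅ nofun nofun nofun (by
      rw [Finset.sum_empty]
      exact congr(($((isZero_zero (EquivariantVectorBundle T X)).eq_of_src 0 (𝟙 _))).hom.hom))⟩

lemma concentrated_biprod (l : Fin t → ℤ) (A B : EquivariantVectorBundle T X)
    (hA : concentrated e hX l A) (hB : concentrated e hX l B) : concentrated e hX l (A ⊞ B) :=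
  isConcentrated_of_comp_eq_id (N := fun b : Bool => cond b A.obj B.obj) Finset.univ
    (fun b => by cases b <;> assumption)
    (fun | true => (biprod.fst : A ⊞ B ⟶ A).hom | false => (biprod.snd : A ⊞ B ⟶ B).hom)
    (fun | true => (biprod.inl : A ⟶ A ⊞ B).hom | false => (biprod.inr : B ⟶ A ⊞ B).hom) (by
      rw [Fintype.sum_bool]
      exact congr(($(biprod.total (X := A) (Y := B))).hom.hom))

lemma exists_isDecomposed [CompactSpace X.left] (M : EquivariantVectorBundle T X) :
    ∃ F, IsDecomposed (concentrated e hX) F M := by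
  classical
  obtain ⟨F, N, i, r, hN, hc, hir, hsum⟩ := exists_weight_decomposition e hX M.obj M.property
  refine ⟨F, fun l => if h : l ∈ F then ObjectProperty.homMk (r ⟨l, h⟩ ≫ i ⟨l, h⟩) else 0,
    fun l hl => ⟨⟨N ⟨l, hl⟩, hN _⟩, ObjectProperty.homMk (i ⟨l, hl⟩),
      ObjectProperty.homMk (r ⟨l, hl⟩), hc ⟨l, hl⟩, ?_, ?_⟩, ?_⟩
  · exact ObjectProperty.hom_ext _ (hir ⟨l, hl⟩)
  · dsimp only
    rw [dif_pos hl]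
    rfl
  · apply (ObjectProperty.ι _).map_injective
    rw [Functor.map_sum, ← Finset.sum_coe_sort]
    refine Eq.trans (Finset.sum_congr rfl fun l _ => ?_) hsum
    rw [dif_pos l.2]
    rfl

lemma hom_eq_zero_of_concentrated (l m : Fin t → ℤ) (hlm : l ≠ m)
    (A B : EquivariantVectorBundle T X) (hA : concentrated e hX l A) (hB : concentrated e hX m B)
    (f : A ⟶ B) : f = 0 :=
  ObjectProperty.hom_ext _ (hom_eq_zero_of_isConcentrated e B.property hlm hA hB f.hom)

theorem isSemiorthogonalDecomposition_hoWeightPart [CompactSpace X.left]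
    (r : (Fin t → ℤ) → (Fin t → ℤ) → Prop) [IsStrictTotalOrder (Fin t → ℤ) r] :
    IsSemiorthogonalDecomposition r (fun l => hoWeightPart e hX l) where
  isTriangulated l := hoBoundedOf_isTriangulated (concentrated e hX l) (concentrated_biprod e hX l)
  hom_eq_zero i j hij A B hA hB f := by
    -- The order enters only here, through irreflexivity. The morphism is then represented by a
    -- chain map, which is already zero in every degree before passing to homotopy.
    have hne : j ≠ i := fun h => irrefl_of r i (h ▸ hij)
    obtain ⟨g : A.obj.as ⟶ B.obj.as, hg⟩ := (HomotopyCategory.quotient _ _).map_surjective f.hom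
    have h0 : g = 0 := HomologicalComplex.hom_ext _ _ fun n =>
      hom_eq_zero_of_concentrated e hX j i hne _ _ (hA.2 n) (hB.2 n) (g.f n)
    apply ObjectProperty.hom_ext
    rw [← hg, h0]
    exact Functor.map_zero _ _ _
  generate Q _ _ hA A :=
    prop_of_isDecomposed (hom_eq_zero_of_concentrated e hX) (exists_isDecomposed e hX) Q hA A

end TorusPerf
end

theorem mainTheorem11 {S : Scheme.{u}} (t : ℕ) (T : Over S) [GrpObj T]
    (e : TorusPerf.TorusSplitting T t) (X : Over S) [CompactSpace X.left] [ModObj T X]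
    (hX : TorusPerf.IsTrivialAction T X) :
    (∀ l : Fin t → ℤ, (TorusPerf.forgetWeightPart e hX l).IsEquivalence) ∧
    (∀ m l : Fin t → ℤ, m ≠ l → ∀ M L : TorusPerf.SPerfEquivariant T X,
      TorusPerf.weightComplexes e hX m M.obj → TorusPerf.weightComplexes e hX l L.obj →
      (∀ (n : ℤ) (f : TorusPerf.DGCategory.hom M L n), f = 0) ∧
      (∀ (n : ℤ) (f : TorusPerf.DGCategory.hom L M n), f = 0)) ∧
    (∀ (r : (Fin t → ℤ) → (Fin t → ℤ) → Prop) [IsStrictTotalOrder (Fin t → ℤ) r],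
      TorusPerf.IsSemiorthogonalDecomposition r
        (fun l => TorusPerf.hoWeightPart e hX l)) :=
  ⟨TorusPerf.forgetWeightPart_isEquivalence e hX,
    fun _ _ hml _ _ hM hL => ⟨TorusPerf.cochain_eq_zero e hX hml hM hL,
      TorusPerf.cochain_eq_zero e hX hml.symm hL hM⟩,
    fun r _ => TorusPerf.isSemiorthogonalDecomposition_hoWeightPart e hX r⟩
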